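/- **Setting.** Let $S^2$ be an oriented topological 2-sphere. A continuous map $f\colon S^2\to S^2$ is a *branched covering map* if for each $x\in S^2$ there are an integer $d\ge 1$ (the *local degree* $\deg_f(x)$) and orientation-preserving homeomorphisms $\varphi\colon U\to U'$, $\eta\colon V\to V'$ from open neighborhoods $U$ of $x$ and $V$ of $f(x)$ onto open neighborhoods of $0$ in $\mathbb{C}$ such that $\varphi(x)=0$, $\eta(f(x))=0$, $f(U)\subseteq V$, and $(\eta\circ f\circ\varphi^{-1})(z)=z^d$ on $U'$. The *degree* of $f$ is $\sum_{x\in f^{-1}(y)}\deg_f(x)$, which is independent of $y\in S^2$. Let $\operatorname{crit} f=\{x:\deg_f(x)\ge 2\}$ and $\operatorname{post} f=\{f^n(x): x\in\operatorname{crit} f,\ n\ge 1\}$. A *Thurston map* is a branched covering map $f\colon S^2\to S^2$ of degree at least $2$ such that $\operatorname{post} f$ is finite. A *cell* of dimension $n\in\{0,1,2\}$ is a subset of $S^2$ homeomorphic to the closed unit ball of $\mathbb{R}^n$; its boundary corresponds to the unit sphere, and its interior is the rest of the cell. A *cell decomposition* of $S^2$ is a collection of cells that covers $S^2$, such that the boundary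 of each of its cells is a union of its cells, distinct cells have disjoint interiors, and every point has a neighborhood meeting only finitely many cells. Let $f$ be a Thurston map and $\mathcal{C}\subseteq S^2$ a Jordan curve with $\operatorname{post} f\subseteq\mathcal{C}$. The *$0$-tiles* $X^0_{\mathfrak{b}}$ (black) and $X^0_{\mathfrak{w}}$ (white) are the closures of the two components of $S^2\setminus\mathcal{C}$. Let $\mathbf{D}^0$ consist of the $0$-tiles, the closures of the components of $\mathcal{C}\setminus\operatorname{post} f$, and the singletons $\{p\}$ with $p\in\operatorname{post} f$. Let $(\mathbf{D}^n)_{n\ge 0}$ be the unique sequence of cell decompositions of $S^2$ starting with $\mathbf{D}^0$ such that for every $n\ge 0$ the map $f$ sends each cell of $\mathbf{D}^{n+1}$ homeomorphically onto a cell of $\mathbf{D}^n$. The 2-dimensional cells of $\mathbf{D}^n$ are called *$n$-tiles*, and $\mathbf{X}^n(f,\mathcal{C})$ is the set of all $n$-tiles. The map $f$ is *expanding* if, for some Jordan curve $\mathcal{C}'\supseteq\operatorname{post} f$ and some metric inducing the topology of $S^2$, the maximal diameter of the tiles in $\mathbf{X}^n(f,\mathcal{C}')$ tends to $0$ as $n\to\infty$.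 A *subsystem* of $f$ with respect to $\mathcal{C}$ is a map $F=f|_{\operatorname{dom}F}\colon\operatorname{dom}F\to S^2$, where $\operatorname{dom}F=\bigcup\mathfrak{X}$ for some non-empty $\mathfrak{X}\subseteq\mathbf{X}^1(f,\mathcal{C})$. For $n\ge 0$ its *$n$-tiles* are the $X\in\mathbf{X}^n(f,\mathcal{C})$ with $X\subseteq F^{-n}(F(\operatorname{dom}F))$, where $F^n$ is the $n$-th iterate of the partial map $F$ and $F^0=\mathrm{id}_{S^2}$. Let $\mathfrak{X}^n(F)$ be the set of the $n$-tiles of $F$, and for $c\in\{\mathfrak{b},\mathfrak{w}\}$ let $\mathfrak{X}^n_c(F)=\{X\in\mathfrak{X}^n(F):F^n(X)=X^0_c\}$. The *tile maximal invariant set* of $F$ is $\Lambda=\bigcap_{n\ge 1}\bigcup\mathfrak{X}^n(F)$. The subsystem $F$ is *irreducible* if for all $c,c'\in\{\mathfrak{b},\mathfrak{w}\}$ there are $n\ge 1$ and $X\in\mathfrak{X}^n_c(F)$ with $X\subseteq X^0_{c'}$. It is *primitive* if there is $N\ge 1$ such that for all $c,c'\in\{\mathfrak{b},\mathfrak{w}\}$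 and all $n\ge N$ there is $X\in\mathfrak{X}^n_c(F)$ with $X\subseteq X^0_{c'}$. A continuous map $T\colon X\to X$ is *topologically transitive* if for all non-empty open $U,V\subseteq X$ there is $n\ge 0$ with $T^n(U)\cap V\ne\emptyset$, and *topologically mixing* if for all non-empty open $U,V\subseteq X$ there is $N\ge 0$ with $T^n(U)\cap V\neq\emptyset$ for all $n\ge N$. **Proposition 6.8.** Let $f\colon S^2\to S^2$ be an expanding Thurston map, let $\mathcal{C}\subseteq S^2$ be a Jordan curve with $\operatorname{post} f\subseteq\mathcal{C}$ and $f(\mathcal{C})\subseteq\mathcal{C}$, and let $F$ be a subsystem of $f$ with respect to $\mathcal{C}$, with tile maximal invariant set $\Lambda$. Then $F$ restricts to a well-defined continuous map $F|_\Lambda\colon\Lambda\to\Lambda$, and the following statements hold. 1. If $F$ is irreducible, then $F|_\Lambda$ is topologically transitive, and there is $x\in\Lambda$ whose forward orbit $\{F^n(x):n\ge 0\}$ is dense in $\Lambda$. 2. If $F$ is primitive, then $F|_\Lambda$ is topologically mixing. -/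

import Mathlib

open Set Filter Topology

namespace ThurstonMap

noncomputable section

/-! ### Oriented topological 2-spheres and branched covering maps -/

/-- An oriented topological 2-sphere: a space with a homeomorphism onto the Riemann sphere.
The orientation is the standard one of the Riemann sphere, transported by this homeomorphism. -/
class OrientedSphere (S : Type*) [TopologicalSpace S] where
  /-- the homeomorphism onto the Riemann sphere that fixes the orientation -/
  toRiemannSphere : S ≃ₜ OnePoint ℂ

/-- `g` winds exactly once counterclockwise around `g w` along every small circle that is centred
at `w` and traversed counterclockwise: the argument of `g (w + r e^{it}) - g w` has a continuous
branch `θ` that increases by `2π` in total. -/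
def WindsOnceAt (g : ℂ → ℂ) (w : ℂ) : Prop :=
  ∀ᶠ r : ℝ in 𝓝[>] 0, ∃ θ : ℝ → ℝ, Continuous θ ∧ θ (2 * Real.pi) = θ 0 + 2 * Real.pi ∧
    ∀ t : ℝ, g (w + r * Complex.exp (t * Complex.I)) - g w =
      (‖g (w + r * Complex.exp (t * Complex.I)) - g w‖ : ℂ) * Complex.exp (θ t * Complex.I)

section Branched

variable {S : Type*} [TopologicalSpace S] [OrientedSphere S]

/-- A homeomorphism between an open subset of the oriented sphere `S` and an open subset of `ℂ` is
orientation-preserving. (The one point of `S` that corresponds to `∞` may be left out of the test,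
since being orientation-preserving is a locally constant property of the points.) -/
def OrientationPreserving (φ : OpenPartialHomeomorph S ℂ) : Prop :=
  ∀ w : ℂ, (OrientedSphere.toRiemannSphere (S := S)).symm (w : OnePoint ℂ) ∈ φ.source →
    WindsOnceAt
      (fun z : ℂ => φ ((OrientedSphere.toRiemannSphere (S := S)).symm (z : OnePoint ℂ))) w

/-- In suitable orientation-preserving local charts `φ : U → U'` at `x` and `η : V → V'` at `f x`,
both centred at `0`, the map `f` is `z ↦ z ^ d`, where `d ≥ 1`. -/
def HasLocalDegree (f : S → S) (x : S) (d : ℕ) : Prop :=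
  1 ≤ d ∧ ∃ φ η : OpenPartialHomeomorph S ℂ,
    OrientationPreserving φ ∧ OrientationPreserving η ∧
    x ∈ φ.source ∧ f x ∈ η.source ∧ φ x = 0 ∧ η (f x) = 0 ∧
    MapsTo f φ.source η.source ∧ ∀ z ∈ φ.target, η (f (φ.symm z)) = z ^ d

/-- A branched covering map on `S`. -/
def IsBranchedCovering (f : S → S) : Prop :=
  Continuous f ∧ ∀ x, ∃ d, HasLocalDegree f x d

/-- The local degree of `f` at `x` (there is exactly one `d` with `HasLocalDegree f x d` if `f` is
a branched covering map). -/
def localDegree (f : S → S) (x : S) : ℕ := sInf {d | HasLocalDegree f x d}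

/-- The number of preimages of `y`, counted with local degrees. For a branched covering map on `S`
the sum is finite and its value does not depend on `y`: it is the degree of `f`. -/
def degreeAt (f : S → S) (y : S) : ℕ := ∑ᶠ x ∈ f ⁻¹' {y}, localDegree f x

/-- The set of critical points. -/
def crit (f : S → S) : Set S := {x | 2 ≤ localDegree f x}

/-- The set of postcritical points. -/
def post (f : S → S) : Set S := {y | ∃ x ∈ crit f, ∃ n : ℕ, 1 ≤ n ∧ y = f^[n] x}

/-- A Thurston map: a branched covering map of degree at least 2 with finitely many postcritical
points. -/
structure IsThurstonMap (f : S → S) : Prop where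
  branched : IsBranchedCovering f
  two_le_degree : ∀ y, 2 ≤ degreeAt f y
  finite_post : (post f).Finite

end Branched

/-! ### Cells and cell decompositions -/

section Cells

variable {S : Type*} [TopologicalSpace S]

/-- The closed unit ball of `ℝⁿ`. -/
abbrev UnitBall (n : ℕ) : Set (EuclideanSpace ℝ (Fin n)) := Metric.closedBall 0 1

/-- `c` is a cell of dimension `n`: it is homeomorphic to the closed unit ball of `ℝⁿ` (a single
point if `n = 0`). -/
def IsCell (n : ℕ) (c : Set S) : Prop := Nonempty (UnitBall n ≃ₜ c)

/-- The boundary of a cell (of dimension 0, 1 or 2): the points that correspond to the unit sphere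
under a homeomorphism with the closed unit ball. It is empty for a cell of dimension 0. -/
def cellBoundary (c : Set S) : Set S :=
  {x | ∃ n ≤ 2, ∃ (e : UnitBall n ≃ₜ c) (u : UnitBall n),
    ‖(u : EuclideanSpace ℝ (Fin n))‖ = 1 ∧ (e u : S) = x}

/-- The interior of a cell. -/
def cellInterior (c : Set S) : Set S := c \ cellBoundary c

/-- `D` is a cell decomposition of `S`. -/
structure IsCellDecomposition (D : Set (Set S)) : Prop where
  isCell : ∀ c ∈ D, ∃ n ≤ 2, IsCell n c
  sUnion_eq : ⋃₀ D = univ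
  boundary : ∀ c ∈ D, ∃ E ⊆ D, cellBoundary c = ⋃₀ E
  disjoint : ∀ c₁ ∈ D, ∀ c₂ ∈ D, c₁ ≠ c₂ → Disjoint (cellInterior c₁) (cellInterior c₂)
  locallyFinite : ∀ x : S, ∃ U ∈ 𝓝 x, {c ∈ D | (c ∩ U).Nonempty}.Finite

/-- `f` is cellular for `(D', D)`: it maps every cell of `D'` homeomorphically onto a cell
of `D`. -/
def IsCellular (f : S → S) (D' D : Set (Set S)) : Prop :=
  ∀ c ∈ D', f '' c ∈ D ∧ IsEmbedding (c.domRestrict f)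

/-- A Jordan curve: a homeomorphic image of the circle. -/
def IsJordanCurve (C : Set S) : Prop := Nonempty (Circle ≃ₜ C)

/-- The closures of the connected components of `A`. -/
def closedComponents (A : Set S) : Set (Set S) :=
  {X | ∃ x ∈ A, X = closure (connectedComponentIn A x)}

/-- The two `0`-tiles (the black one and the white one) of a Jordan curve `C`. -/
def zeroTiles (C : Set S) : Set (Set S) := closedComponents Cᶜ

end Cells

/-! ### The cell decompositions of a Thurston map and a Jordan curve -/

section Tiles

variable {S : Type*} [τ : TopologicalSpace S] [OrientedSphere S]

/-- The cells of level 0: `0`-tiles, `0`-edges and `0`-vertices. -/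
def zeroCells (f : S → S) (C : Set S) : Set (Set S) :=
  zeroTiles C ∪ closedComponents (C \ post f) ∪ {c | ∃ x ∈ post f, c = {x}}

/-- `D 0, D 1, D 2, …` are cell decompositions of `S`, the first one consists of the `0`-cells, and
`f` is cellular for `(D (n + 1), D n)` for every `n`. -/
def IsCellSequence (f : S → S) (C : Set S) (D : ℕ → Set (Set S)) : Prop :=
  D 0 = zeroCells f C ∧ (∀ n, IsCellDecomposition (D n)) ∧
    ∀ n, IsCellular f (D (n + 1)) (D n)

open Classical in
/-- The set of `n`-cells for `(f, C)`. If `f` is a Thurston map and `C` is a Jordan curve that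
contains `post f`, then there is exactly one sequence of cell decompositions as in
`IsCellSequence`, and this is its `n`-th member. -/
def cells (f : S → S) (C : Set S) (n : ℕ) : Set (Set S) :=
  if h : ∃ D, IsCellSequence f C D then h.choose n else ∅

/-- The set of `n`-tiles for `(f, C)`: the `n`-cells of dimension 2. -/
def tiles (f : S → S) (C : Set S) (n : ℕ) : Set (Set S) := {X ∈ cells f C n | IsCell 2 X}

/-- The maximum `m n` of the `d`-diameters of the members of `𝒯 n` exists for every `n`, and tends
to `0` as `n → ∞`. -/
def MaxDiamTendsToZero {M : Type*} (d : MetricSpace M) (𝒯 : ℕ → Set (Set M)) : Prop :=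
  ∃ m : ℕ → ℝ, (∀ n, IsGreatest (Metric.diam '' 𝒯 n) (m n)) ∧ Tendsto m atTop (𝓝 0)

/-- A Thurston map `f` is expanding: for some Jordan curve `C` that contains `post f` and some
metric `d` that induces the topology `τ` of `S`, the maximal diameter of the `n`-tiles tends
to `0` as `n → ∞`. -/
def IsExpanding (f : S → S) : Prop :=
  ∃ C : Set S, IsJordanCurve C ∧ post f ⊆ C ∧
    ∃ 𝒯 : ℕ → Set (Set S), 𝒯 = tiles f C ∧
      ∃ d : MetricSpace S, d.toPseudoMetricSpace.toUniformSpace.toTopologicalSpace = τ ∧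
        MaxDiamTendsToZero d 𝒯

/-! ### Subsystems -/

/-- `F` is a subsystem of `f` with respect to `C`: the restriction of `f` to the union of a
non-empty set of `1`-tiles. -/
def IsSubsystem (f : S → S) (C : Set S) (F : S →. S) : Prop :=
  ∃ 𝔛 ⊆ tiles f C 1, 𝔛.Nonempty ∧ F = PFun.res f (⋃₀ 𝔛)

/-- The `n`-th iterate of a partial map, defined wherever all the intermediate values exist. -/
def iter (F : S →. S) : ℕ → (S →. S)
  | 0 => PFun.id S
  | n + 1 => (iter F n).comp F

/-- The set of `n`-tiles of the subsystem `F`: the `n`-tiles contained in `F⁻ⁿ(F(dom F))`. -/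
def subTiles (f : S → S) (C : Set S) (F : S →. S) (n : ℕ) : Set (Set S) :=
  {X ∈ tiles f C n | X ⊆ (iter F n).preimage (F.image F.Dom)}

/-- The `n`-tiles of `F` that `Fⁿ` maps onto the `0`-tile `A`. Thus the black `n`-tiles of `F` are
obtained if `A` is the black `0`-tile, and the white ones if `A` is the white `0`-tile. -/
def colorTiles (f : S → S) (C : Set S) (F : S →. S) (n : ℕ) (A : Set S) : Set (Set S) :=
  {X ∈ subTiles f C F n | (iter F n).image X = A}

/-- The tile maximal invariant set of `F`. -/
def limitSet (f : S → S) (C : Set S) (F : S →. S) : Set S :=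
  ⋂ n : ℕ, ⋂ _ : 1 ≤ n, ⋃₀ subTiles f C F n

/-- `F` is irreducible. The colors are represented by the `0`-tiles that bear them. -/
def IsIrreducible (f : S → S) (C : Set S) (F : S →. S) : Prop :=
  ∀ A ∈ zeroTiles C, ∀ B ∈ zeroTiles C, ∃ n : ℕ, 1 ≤ n ∧ ∃ X ∈ colorTiles f C F n A, X ⊆ B

/-- `F` is primitive. The colors are represented by the `0`-tiles that bear them. -/
def IsPrimitive (f : S → S) (C : Set S) (F : S →. S) : Prop :=
  ∃ N : ℕ, 1 ≤ N ∧ ∀ A ∈ zeroTiles C, ∀ B ∈ zeroTiles C, ∀ n ≥ N,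
    ∃ X ∈ colorTiles f C F n A, X ⊆ B

end Tiles

/-! ### Topological dynamics -/

/-- `T` is topologically transitive. -/
def TopTransitive {X : Type*} [TopologicalSpace X] (T : X → X) : Prop :=
  ∀ U V : Set X, IsOpen U → IsOpen V → U.Nonempty → V.Nonempty →
    ∃ n : ℕ, (T^[n] '' U ∩ V).Nonempty

/-- `T` is topologically mixing. -/
def TopMixing {X : Type*} [TopologicalSpace X] (T : X → X) : Prop :=
  ∀ U V : Set X, IsOpen U → IsOpen V → U.Nonempty → V.Nonempty →
    ∃ N : ℕ, ∀ n ≥ N, (T^[n] '' U ∩ V).Nonempty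

/-- `T` has a dense forward orbit. -/
def HasDenseForwardOrbit {X : Type*} [TopologicalSpace X] (T : X → X) : Prop :=
  ∃ x : X, Dense (range fun n : ℕ => T^[n] x)

end

end ThurstonMap

/-! Let `F` be `f` restricted to a union `s` of 1-tiles. Expansion makes tiles of high level small,
and `f(C) ⊆ C` puts every tile inside a tile of each lower level. If `U` is open and meets `Λ`, some
`n`-tile `X` of `F` lies in `U`, and `f^[n]` maps it onto a 0-tile `A`. If `y ∈ Λ`, some 0-tile `B`
contains tiles of `F` around `y` at infinitely many levels. Suppose that a tile `T ⊆ A` of `F` of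
level `l` satisfies `f^[l] '' T = B`. Pulling back `T`, and then the tiles around `y`, gives tiles
of `F` of unbounded level in `X` that share a point; this point is in `Λ`, and `f^[l + n]` sends it
to `y` (`exists_mem_survivingLimit_iterate_eq`, `exists_hitting_time`). Irreducibility supplies one
such `l`, primitivity all large ones, and `n` depends only on `U`. A dense orbit follows from
transitivity by Baire category, as `Λ` is compact, metrizable and, by irreducibility, nonempty
(`survivingLimit_nonempty`).

Expansion is given for some curve, not for `C`. It carries over because an `n`-cell for one curve is
crossed by a chain of `n`-stars for the other whose length is bounded independently of `n`
(`IsTower.exists_dist_le`).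

Two devices replace dimension theory. Contractibility of the punctured ball tells boundary points of
a cell from interior ones. Sets that inject into the circle (`IsThin`) include cells of dimension at
most 1 and boundaries of 2-cells, but no disc, and finitely many closed ones cannot cover a plane.
-/

namespace ThurstonMap

/-! ### The circle -/

/-- The loop once around the circle becomes null-homotopic in `X`, hence after applying `π` also in
the circle. But its lift through `Circle.exp` ends at `2π`, that of the constant loop at `0`. -/
theorem not_retract_circle {X : Type*} [TopologicalSpace X] [SimplyConnectedSpace X]
    (γ : C(Circle, X)) (π : C(X, Circle)) (h : ∀ z, π (γ z) = z) : False := by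
  have hcont : Continuous fun t : unitInterval => Circle.exp (2 * Real.pi * t) := by fun_prop
  let p₁ : Path (1 : Circle) 1 := ⟨⟨_, hcont⟩, by simp, by simp⟩
  let p₂ : Path (1 : Circle) 1 := Path.refl 1
  have h₁ : Path.Homotopic (p₁.map γ.continuous) (p₂.map γ.continuous) :=
    SimplyConnectedSpace.paths_homotopic _ _
  have h₂ : ContinuousMap.HomotopicRel (π.comp (p₁.map γ.continuous).toContinuousMap)
      (π.comp (p₂.map γ.continuous).toContinuousMap) {0, 1} := by
    obtain ⟨H⟩ := h₁
    exact ⟨H.compContinuousMap π⟩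
  have e₁ : π.comp (p₁.map γ.continuous).toContinuousMap = p₁.toContinuousMap := by
    ext t; simp [h]
  have e₂ : π.comp (p₂.map γ.continuous).toContinuousMap = p₂.toContinuousMap := by
    ext t; simp [h]
  rw [e₁, e₂] at h₂
  have key := Circle.isCoveringMap_exp.liftPath_apply_one_eq_of_homotopicRel h₂ 0
    (by simp [p₁]) (by simp [p₂])
  have l₁ : (⟨fun t : unitInterval => 2 * Real.pi * t, by fun_prop⟩ : C(unitInterval, ℝ)) =
      Circle.isCoveringMap_exp.liftPath p₁.toContinuousMap 0 (by simp [p₁]) := by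
    rw [Circle.isCoveringMap_exp.eq_liftPath_iff']
    refine ⟨?_, by simp⟩
    ext t; simp [p₁]
  have l₂ : ContinuousMap.const unitInterval (0 : ℝ) =
      Circle.isCoveringMap_exp.liftPath p₂.toContinuousMap 0 (by simp [p₂]) := by
    rw [Circle.isCoveringMap_exp.eq_liftPath_iff']
    refine ⟨?_, by simp⟩
    ext t; simp [p₂]
  rw [← l₁, ← l₂] at key
  simp [Real.pi_ne_zero] at key

/-- One-dimensional Borsuk–Ulam: with `a = -1`, the function `g z - g (a * z)` is odd under the
antipodal map, so it vanishes somewhere. -/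
theorem not_injective_circle_real {g : Circle → ℝ} (hg : Continuous g) :
    ¬ Function.Injective g := by
  intro hinj
  set a : Circle := Circle.exp Real.pi
  have ha : a * a = 1 := by
    rw [← Circle.exp_add]; ring_nf; rw [mul_comm]; exact Circle.exp_two_pi
  have ha1 : a ≠ 1 := by
    intro h
    have := congrArg (fun z : Circle => (z : ℂ)) h
    simp [a, Circle.coe_exp] at this
    norm_num at this
  have hc : Continuous fun z : Circle => g z - g (a * z) := by fun_prop
  have hpc : IsPreconnected (univ : Set Circle) := by
    have : range Circle.exp = univ := by
      ext z; simpa using ⟨_, Circle.exp_arg z⟩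
    rw [← this]
    exact isPreconnected_range Circle.exp.continuous
  have h1 : g (a * 1) - g (a * (a * 1)) = -(g 1 - g (a * 1)) := by
    rw [← mul_assoc, ha]; simp
  have hz : ∃ z : Circle, g z - g (a * z) = 0 := by
    rcases le_total (g 1 - g (a * 1)) 0 with h | h
    · obtain ⟨z, -, hz⟩ := hpc.intermediate_value₂ (f := fun z => g z - g (a * z)) (g := fun _ => 0)
        (mem_univ 1) (mem_univ (a * 1)) hc.continuousOn continuousOn_const h (by linarith)
      exact ⟨z, hz⟩
    · obtain ⟨z, -, hz⟩ := hpc.intermediate_value₂ (f := fun z => g z - g (a * z)) (g := fun _ => 0)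
        (mem_univ (a * 1)) (mem_univ 1) hc.continuousOn continuousOn_const (by linarith) h
      exact ⟨z, hz⟩
  obtain ⟨z, hz⟩ := hz
  have := hinj (sub_eq_zero.1 hz)
  exact ha1 (by simpa using this.symm)

/-- If `w` is missed, rotating `w` to `-1` moves the image into the slit plane, where `Complex.arg`
is continuous; this gives an injective real function on the circle. -/
theorem surjective_of_injective_circle {g : Circle → Circle} (hg : Continuous g)
    (hinj : Function.Injective g) : Function.Surjective g := by
  by_contra hs
  obtain ⟨w, hw⟩ := not_forall.1 hs
  have hw : ∀ z, g z ≠ w := fun z hz => hw ⟨z, hz⟩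
  set a : Circle := Circle.exp Real.pi
  have ha : (a : ℂ) = -1 := by simp [a, Circle.coe_exp]
  have hsl : ∀ z, ((a * (g z / w) : Circle) : ℂ) ∈ Complex.slitPlane := by
    intro z
    rw [Complex.mem_slitPlane_iff_arg]
    refine ⟨fun h => hw z ?_, Circle.coe_ne_zero _⟩
    have h2 : a * (g z / w) = a := by
      rw [← Circle.exp_arg (a * (g z / w)), h]
    simpa [div_eq_one] using h2
  refine not_injective_circle_real (g := fun z => Complex.arg ((a * (g z / w) : Circle) : ℂ)) ?_ ?_
  · rw [continuous_iff_continuousAt]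
    intro z
    have h1 : Continuous fun z => ((a * (g z / w) : Circle) : ℂ) := by fun_prop
    exact ContinuousAt.comp (f := fun z => ((a * (g z / w) : Circle) : ℂ))
      (Complex.continuousAt_arg (hsl z)) h1.continuousAt
  · intro z₁ z₂ h
    have := Circle.injective_arg h
    exact hinj (by simpa using this)

/-! ### Sets that inject into the circle -/

/-- `A` admits an injective continuous map into the circle. -/
def IsThin {S : Type*} [TopologicalSpace S] (A : Set S) : Prop :=
  ∃ g : A → Circle, Continuous g ∧ Function.Injective g

theorem IsThin.mono {S : Type*} [TopologicalSpace S] {A B : Set S} (hB : IsThin B) (h : A ⊆ B) :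
    IsThin A := by
  obtain ⟨g, hg, hi⟩ := hB
  exact ⟨g ∘ inclusion h, hg.comp (continuous_inclusion h), hi.comp (inclusion_injective h)⟩

/-- Two disjoint concentric circles in the ball would each be mapped onto the whole target circle.
-/
theorem not_isThin_of_ball {S : Type*} [TopologicalSpace S] {A : Set S} {j : ℂ → S}
    (hj : Continuous j) (hinj : Function.Injective j) {c : ℂ} {r : ℝ} (hr : 0 < r)
    (hA : ∀ z ∈ Metric.ball c r, j z ∈ A) : ¬ IsThin A := by
  rintro ⟨g, hg, hgi⟩
  have hmem : ∀ s : ℝ, 0 < s → s < r → ∀ z : Circle, c + s * (z : ℂ) ∈ Metric.ball c r := by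
    intro s hs hsr z
    simp [abs_of_pos hs, hsr, Circle.norm_coe]
  have hsurj : ∀ s (hs : 0 < s) (hsr : s < r),
      Function.Surjective fun z : Circle => g ⟨j (c + s * (z : ℂ)), hA _ (hmem s hs hsr z)⟩ := by
    intro s hs hsr
    apply surjective_of_injective_circle
    · refine hg.comp (Continuous.subtype_mk (hj.comp (by fun_prop)) _)
    · intro z₁ z₂ h
      have := hinj (congrArg Subtype.val (hgi h))
      have hs' : (s : ℂ) ≠ 0 := by exact_mod_cast hs.ne'
      exact Circle.ext (mul_left_cancel₀ hs' (add_left_cancel this))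
  obtain ⟨z, hz⟩ := hsurj (r / 2) (by positivity) (by linarith)
    (g ⟨j (c + ((r / 3 : ℝ) : ℂ) * ((1 : Circle) : ℂ)),
      hA _ (hmem (r / 3) (by positivity) (by linarith) 1)⟩)
  have := add_left_cancel (hinj (congrArg Subtype.val (hgi hz)))
  have := congrArg norm this
  rw [norm_mul, norm_mul, Circle.norm_coe, Circle.norm_coe, Complex.norm_real, Complex.norm_real,
    Real.norm_of_nonneg (by positivity), Real.norm_of_nonneg (by positivity)] at this
  linarith

/-- By Baire, one of finitely many closed sets covering the plane would contain a ball. -/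
theorem exists_notMem_sUnion_of_isThin {S : Type*} [TopologicalSpace S] {𝓕 : Set (Set S)}
    (hfin : 𝓕.Finite) (hcl : ∀ A ∈ 𝓕, IsClosed A) (hthin : ∀ A ∈ 𝓕, IsThin A) {j : ℂ → S}
    (hj : Continuous j) (hinj : Function.Injective j) : ∃ z, j z ∉ ⋃₀ 𝓕 := by
  by_contra! h
  have : Countable 𝓕 := hfin.countable
  obtain ⟨A, z, hz⟩ := nonempty_interior_of_iUnion_of_closed (f := fun A : 𝓕 => j ⁻¹' A)
    (fun A => (hcl A A.2).preimage hj) (by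
      ext z
      obtain ⟨A, hA, hz⟩ := h z
      simpa using ⟨A, hA, hz⟩)
  obtain ⟨r, hr, hball⟩ := Metric.isOpen_iff.1 isOpen_interior z hz
  have hsub : ∀ w ∈ Metric.ball z r, w ∈ j ⁻¹' (A : Set S) := fun w hw =>
    interior_subset (hball hw)
  exact not_isThin_of_ball hj hinj hr hsub (hthin A A.2)

/-! ### Punctured balls -/

/-- A unit vector is an extreme point of the ball, so removing it leaves a convex set. -/
theorem contractibleSpace_punctured_of_norm_eq_one {m : ℕ} {u : UnitBall m}
    (hu : ‖(u : EuclideanSpace ℝ (Fin m))‖ = 1) : ContractibleSpace {x : UnitBall m // x ≠ u} := by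
  set E := EuclideanSpace ℝ (Fin m)
  have hconv : Convex ℝ (Metric.closedBall (0 : E) 1 \ {(u : E)}) := by
    have hext : (u : E) ∈ (Metric.closedBall (0 : E) 1).extremePoints ℝ :=
      StrictConvexSpace.sphere_subset_extremePoints_closedBall 0 one_ne_zero (by simpa using hu)
    exact (convex_closedBall (0 : E) 1).mem_extremePoints_iff_convex_sdiff.1 hext |>.2
  have hne : (Metric.closedBall (0 : E) 1 \ {(u : E)}).Nonempty := by
    refine ⟨-u, by simp [hu], fun h => ?_⟩
    have : (u : E) = 0 := by
      have h : -(u : E) = u := h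
      have h2 : (2 : ℝ) • (u : E) = 0 := by
        rw [two_smul]; nth_rewrite 1 [← h]; simp
      simpa using h2
    rw [this] at hu
    simp at hu
  have := hconv.contractibleSpace hne
  let e : {x : UnitBall m // x ≠ u} ≃ₜ ↥(Metric.closedBall (0 : E) 1 \ {(u : E)}) :=
    { toFun := fun x => ⟨x.1.1, x.1.2, fun h => x.2 (Subtype.ext h)⟩
      invFun := fun y => ⟨⟨y.1, y.2.1⟩, fun h => y.2.2 (congrArg Subtype.val h)⟩
      left_inv := fun x => rfl
      right_inv := fun y => rfl
      continuous_toFun := by fun_prop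
      continuous_invFun := by fun_prop }
  exact e.contractibleSpace

/-- The punctured ball is empty, disconnected, or retracts onto a circle around `p`, for `n = 0, 1,
2` respectively. -/
theorem not_contractibleSpace_punctured {n : ℕ} (hn : n ≤ 2) {p : UnitBall n}
    (hp : ‖(p : EuclideanSpace ℝ (Fin n))‖ < 1) : ¬ ContractibleSpace {x : UnitBall n // x ≠ p} := by
  intro hcontr
  interval_cases n
  · obtain ⟨x⟩ : Nonempty {x : UnitBall 0 // x ≠ p} := inferInstance
    exact x.2 (Subsingleton.elim _ _)
  · have hc : Continuous fun x : {x : UnitBall 1 // x ≠ p} => (x.1.1 0 : ℝ) := by fun_prop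
    have hmem : ∀ s : ℝ, |s| = 1 → ∃ x : {x : UnitBall 1 // x ≠ p}, x.1.1 0 = s := by
      intro s hs
      refine ⟨⟨⟨EuclideanSpace.single 0 s, by simp [hs]⟩, fun h => ?_⟩, by simp⟩
      rw [← h] at hp
      simp [hs] at hp
    obtain ⟨a, ha⟩ := hmem (-1) (by simp)
    obtain ⟨b, hb⟩ := hmem 1 (by simp)
    have hp' : |(p : EuclideanSpace ℝ (Fin 1)) 0| < 1 := by
      have := EuclideanSpace.norm_eq (p : EuclideanSpace ℝ (Fin 1))
      rw [this] at hp
      simpa [Real.sqrt_sq_eq_abs] using hp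
    obtain ⟨x, hx⟩ := mem_range_of_exists_le_of_exists_ge hc
      (c := (p : EuclideanSpace ℝ (Fin 1)) 0) ⟨a, by rw [ha]; exact (abs_lt.1 hp').1.le⟩
      ⟨b, by rw [hb]; exact (abs_lt.1 hp').2.le⟩
    refine x.2 (Subtype.ext ?_)
    ext i
    rw [Subsingleton.elim i 0]
    exact hx
  · set E := EuclideanSpace ℝ (Fin 2)
    let L : ℂ ≃ₗᵢ[ℝ] E := Complex.orthonormalBasisOneI.repr
    set r : ℝ := 1 - ‖(p : E)‖
    have hr : 0 < r := by simp only [r]; linarith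
    have hr0 : (r : ℂ) ≠ 0 := by exact_mod_cast hr.ne'
    let γ : C(Circle, {x : UnitBall 2 // x ≠ p}) :=
      ⟨fun z => ⟨⟨(p : E) + L (r * z), by
          have h1 : ‖L (r * z)‖ = r := by
            rw [L.norm_map, norm_mul, Circle.norm_coe, Complex.norm_real,
              Real.norm_of_nonneg hr.le, mul_one]
          have := norm_add_le (p : E) (L (r * z))
          rw [h1] at this
          simpa [r] using this⟩, fun h => by
          have h := congrArg Subtype.val h
          simp [hr0] at h⟩, by
        refine Continuous.subtype_mk (Continuous.subtype_mk ?_ _) _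
        exact continuous_const.add (L.continuous.comp (by fun_prop))⟩
    have hne : ∀ x : {x : UnitBall 2 // x ≠ p}, L.symm ((x.1 : E) - p) ≠ 0 := by
      intro x h
      rw [map_eq_zero_iff _ L.symm.injective, sub_eq_zero] at h
      exact x.2 (Subtype.ext h)
    let π : C({x : UnitBall 2 // x ≠ p}, Circle) :=
      ⟨fun x => ⟨L.symm ((x.1 : E) - p) / ‖L.symm ((x.1 : E) - p)‖, by
          apply mem_sphere_zero_iff_norm.2
          rw [norm_div, Complex.norm_real, norm_norm, div_self]
          exact norm_ne_zero_iff.2 (hne x)⟩, by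
        refine Continuous.subtype_mk ?_ _
        have h1 : Continuous fun x : {x : UnitBall 2 // x ≠ p} => L.symm ((x.1 : E) - p) :=
          L.symm.continuous.comp (by fun_prop)
        refine h1.div (Complex.continuous_ofReal.comp h1.norm) fun x => ?_
        exact_mod_cast norm_ne_zero_iff.2 (hne x)⟩
    refine not_retract_circle γ π fun z => ?_
    ext
    change L.symm (((p : E) + L (r * z)) - p) / (‖L.symm (((p : E) + L (r * z)) - p)‖ : ℂ) = z
    rw [add_sub_cancel_left, L.symm_apply_apply, norm_mul, Circle.norm_coe, Complex.norm_real,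
      Real.norm_of_nonneg hr.le, mul_one, mul_div_cancel_left₀ _ hr0]

/-! ### Cells -/

section Cells

variable {S : Type*} [TopologicalSpace S]

theorem norm_symm_eq_one {n m : ℕ} (hn : n ≤ 2) (e : UnitBall n ≃ₜ UnitBall m) {u : UnitBall m}
    (hu : ‖(u : EuclideanSpace ℝ (Fin m))‖ = 1) :
    ‖(e.symm u : EuclideanSpace ℝ (Fin n))‖ = 1 := by
  have hle : ‖(e.symm u : EuclideanSpace ℝ (Fin n))‖ ≤ 1 := mem_closedBall_zero_iff.1 (e.symm u).2
  refine hle.antisymm (not_lt.1 fun hlt => not_contractibleSpace_punctured hn hlt ?_)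
  have := contractibleSpace_punctured_of_norm_eq_one hu
  exact (e.subtype (p := (· ≠ e.symm u)) (q := (· ≠ u)) fun x => by
    rw [not_iff_not, Homeomorph.eq_symm_apply]).contractibleSpace

/-- `cellBoundary` allows every dimension and every parametrization; since homeomorphisms of balls
respect the unit spheres, a single parametrization decides membership. -/
theorem mem_cellBoundary_iff {n : ℕ} (hn : n ≤ 2) {c : Set S} (e : UnitBall n ≃ₜ c)
    (u : UnitBall n) :
    (e u : S) ∈ cellBoundary c ↔ ‖(u : EuclideanSpace ℝ (Fin n))‖ = 1 := by
  refine ⟨?_, fun hu => ⟨n, hn, e, u, hu, rfl⟩⟩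
  rintro ⟨m, hm, e', u', hu', h⟩
  have := norm_symm_eq_one hn (e.trans e'.symm) hu'
  have hu : (e.trans e'.symm).symm u' = u := by
    rw [Homeomorph.symm_apply_eq]
    change u' = e'.symm (e u)
    rw [Homeomorph.eq_symm_apply]
    exact Subtype.ext h
  rwa [hu] at this

theorem cellBoundary_subset (c : Set S) : cellBoundary c ⊆ c := by
  rintro x ⟨n, hn, e, u, hu, rfl⟩
  exact (e u).2

theorem cellInterior_subset (c : Set S) : cellInterior c ⊆ c := sdiff_subset

/-- The center of the closed unit ball. -/
def UnitBall.center (n : ℕ) : UnitBall n := ⟨0, by simp⟩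

theorem IsCell.nonempty {n : ℕ} {c : Set S} (h : IsCell n c) : c.Nonempty := by
  obtain ⟨e⟩ := h
  exact ⟨e (UnitBall.center n), (e _).2⟩

theorem IsCell.isCompact {n : ℕ} {c : Set S} (h : IsCell n c) : IsCompact c := by
  obtain ⟨e⟩ := h
  have : CompactSpace (UnitBall n) := isCompact_iff_compactSpace.1 (isCompact_closedBall _ _)
  exact isCompact_iff_compactSpace.2 e.compactSpace

theorem IsCell.cellBoundary_ne {n : ℕ} (hn : n ≤ 2) {c : Set S} (h : IsCell n c) :
    cellBoundary c ≠ c := by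
  obtain ⟨e⟩ := h
  intro h
  have h0 : (e (UnitBall.center n) : S) ∈ cellBoundary c := by rw [h]; exact (e _).2
  rw [mem_cellBoundary_iff hn] at h0
  simp [UnitBall.center] at h0

theorem isThin_of_continuous {n : ℕ} {c A : Set S} (e : UnitBall n ≃ₜ c) (hA : A ⊆ c)
    {g : EuclideanSpace ℝ (Fin n) → Circle}
    (hg : ContinuousOn g {u | ∃ h : u ∈ UnitBall n, (e ⟨u, h⟩ : S) ∈ A})
    (hinj : InjOn g {u | ∃ h : u ∈ UnitBall n, (e ⟨u, h⟩ : S) ∈ A}) : IsThin A := by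
  have hmem : ∀ x : A, (e.symm ⟨x, hA x.2⟩ : EuclideanSpace ℝ (Fin n)) ∈
      {u | ∃ h : u ∈ UnitBall n, (e ⟨u, h⟩ : S) ∈ A} := fun x => ⟨(e.symm _).2, by simp⟩
  refine ⟨fun x => g (e.symm ⟨x, hA x.2⟩), ?_, ?_⟩
  · exact hg.comp_continuous (by fun_prop) hmem
  · intro x y h
    have := hinj (hmem x) (hmem y) h
    have := e.symm.injective (Subtype.ext this)
    exact Subtype.ext (Subtype.mk.inj this)

theorem IsCell.isThin {n : ℕ} (hn : n ≤ 1) {c : Set S} (h : IsCell n c) : IsThin c := by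
  obtain ⟨e⟩ := h
  interval_cases n
  · exact isThin_of_continuous e subset_rfl (g := fun _ => 1) continuousOn_const
      (fun x _ y _ _ => Subsingleton.elim _ _)
  · refine isThin_of_continuous e subset_rfl (g := fun u => Circle.exp (u 0)) ?_ ?_
    · exact Continuous.continuousOn (by fun_prop)
    · have key : ∀ u ∈ UnitBall 1, u 0 ∈ Ioc (-Real.pi) Real.pi := by
        intro u hu
        rw [mem_closedBall_zero_iff, EuclideanSpace.norm_eq] at hu
        have : |u 0| ≤ 1 := by simpa [Real.sqrt_sq_eq_abs] using hu
        have := abs_le.1 this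
        have := Real.pi_gt_three
        constructor <;> linarith
      rintro u ⟨hu, -⟩ v ⟨hv, -⟩ h
      have := congrArg (fun z : Circle => Complex.arg z) h
      simp only at this
      rw [Circle.arg_exp (key u hu).1 (key u hu).2, Circle.arg_exp (key v hv).1 (key v hv).2] at this
      ext i
      rwa [Subsingleton.elim i 0]

theorem IsCell.isThin_cellBoundary {c : Set S} (h : IsCell 2 c) : IsThin (cellBoundary c) := by
  obtain ⟨e⟩ := h
  let L : EuclideanSpace ℝ (Fin 2) ≃ₗᵢ[ℝ] ℂ := Complex.orthonormalBasisOneI.repr.symm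
  have hn : ∀ x : cellBoundary c,
      ‖L (e.symm ⟨x, cellBoundary_subset c x.2⟩ : EuclideanSpace ℝ (Fin 2))‖ = 1 := by
    intro x
    rw [L.norm_map, ← mem_cellBoundary_iff le_rfl e]
    simp
  refine ⟨fun x => ⟨L (e.symm ⟨x, cellBoundary_subset c x.2⟩ : EuclideanSpace ℝ (Fin 2)),
    mem_sphere_zero_iff_norm.2 (hn x)⟩, ?_, ?_⟩
  · exact Continuous.subtype_mk (L.continuous.comp (by fun_prop)) _
  · intro x y h
    have := e.symm.injective (Subtype.ext (L.injective (congrArg Subtype.val h)))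
    exact Subtype.ext (Subtype.mk.inj this)

/-- The interior of a 2-cell is parametrized by the plane. -/
theorem IsCell.exists_plane {c : Set S} (h : IsCell 2 c) :
    ∃ j : ℂ → S, Continuous j ∧ Function.Injective j ∧ range j = cellInterior c := by
  obtain ⟨e⟩ := h
  let L : ℂ ≃ₗᵢ[ℝ] EuclideanSpace ℝ (Fin 2) := Complex.orthonormalBasisOneI.repr
  let b := Homeomorph.unitBall (E := EuclideanSpace ℝ (Fin 2))
  let i : Metric.ball (0 : EuclideanSpace ℝ (Fin 2)) 1 → UnitBall 2 :=
    inclusion Metric.ball_subset_closedBall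
  refine ⟨fun z => e (i (b (L z))), ?_, ?_, ?_⟩
  · have : Continuous i := continuous_inclusion _
    fun_prop
  · intro z w h
    exact L.injective (b.injective (inclusion_injective _ (e.injective (Subtype.ext h))))
  · ext x
    constructor
    · rintro ⟨z, rfl⟩
      refine ⟨(e _).2, ?_⟩
      rw [mem_cellBoundary_iff le_rfl]
      exact (mem_ball_zero_iff.1 (b (L z)).2).ne
    · rintro ⟨hx, hx'⟩
      have hlt : ‖(e.symm ⟨x, hx⟩ : EuclideanSpace ℝ (Fin 2))‖ < 1 := by
        refine lt_of_le_of_ne (mem_closedBall_zero_iff.1 (e.symm ⟨x, hx⟩).2) fun h => hx' ?_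
        have := (mem_cellBoundary_iff le_rfl e (e.symm ⟨x, hx⟩)).2 h
        simpa using this
      refine ⟨L.symm (b.symm ⟨e.symm ⟨x, hx⟩, mem_ball_zero_iff.2 hlt⟩), ?_⟩
      simp [i]

theorem IsCell.not_isThin {c : Set S} (h : IsCell 2 c) : ¬ IsThin c := by
  obtain ⟨j, hj, hinj, hr⟩ := h.exists_plane
  refine not_isThin_of_ball hj hinj (c := 0) one_pos fun z _ => cellInterior_subset c ?_
  rw [← hr]
  exact mem_range_self z

theorem IsCell.isPreconnected_cellInterior {c : Set S} (h : IsCell 2 c) :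
    IsPreconnected (cellInterior c) := by
  obtain ⟨j, hj, -, hr⟩ := h.exists_plane
  rw [← hr]
  exact isPreconnected_range hj

theorem IsCell.cellInterior_nonempty {c : Set S} (h : IsCell 2 c) : (cellInterior c).Nonempty := by
  obtain ⟨j, -, -, hr⟩ := h.exists_plane
  rw [← hr]
  exact range_nonempty j

theorem IsCell.subset_closure_cellInterior {c : Set S} (h : IsCell 2 c) :
    c ⊆ closure (cellInterior c) := by
  obtain ⟨e⟩ := h
  intro x hx
  obtain ⟨u, hu⟩ := e.surjective ⟨x, hx⟩
  have hcont : Continuous fun t : unitInterval => (e ⟨(t : ℝ) • (u : EuclideanSpace ℝ (Fin 2)), by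
      rw [mem_closedBall_zero_iff, norm_smul, Real.norm_of_nonneg t.2.1]
      -- The radial path `t ↦ t • u` stays in the open ball for `t < 1` and ends at `u`.
      exact mul_le_one₀ t.2.2 (norm_nonneg _) (mem_closedBall_zero_iff.1 u.2)⟩ : S) := by fun_prop
  have hd : Dense {t : unitInterval | (t : ℝ) < 1} := by
    have : {t : unitInterval | (t : ℝ) < 1} = {1}ᶜ := by
      ext t
      simp only [mem_ofPred_eq, mem_compl_iff, mem_singleton_iff]
      exact ⟨fun h h' => by simp [h'] at h, fun h =>
        lt_of_le_of_ne t.2.2 fun h' => h (Subtype.ext h')⟩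
    rw [this]
    exact dense_compl_singleton 1
  have := map_mem_closure (t := cellInterior c) hcont (hd 1) (fun t ht => by
    refine ⟨(e _).2, ?_⟩
    rw [mem_cellBoundary_iff le_rfl]
    simp only [norm_smul, Real.norm_of_nonneg t.2.1]
    refine (lt_of_le_of_lt ?_ ht).ne
    exact mul_le_of_le_one_right t.2.1 (mem_closedBall_zero_iff.1 u.2))
  simpa [hu] using this

end Cells

/-! ### Images of cells -/

section Image

variable {S : Type*} [TopologicalSpace S] [T2Space S]

theorem exists_homeomorph_image {f : S → S} (hf : Continuous f) {c : Set S} (hc : IsCompact c)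
    (hinj : InjOn f c) : ∃ h : c ≃ₜ (f '' c), ∀ x, (h x : S) = f x := by
  have := isCompact_iff_compactSpace.1 hc
  let e : c ≃ f '' c := Equiv.Set.imageOfInjOn f c hinj
  have he : Continuous e := Continuous.subtype_mk (hf.comp continuous_subtype_val) _
  exact ⟨he.homeoOfEquivCompactToT2, fun x => rfl⟩

theorem isCell_image_iff {f : S → S} (hf : Continuous f) {c : Set S} (hc : IsCompact c)
    (hinj : InjOn f c) {n : ℕ} : IsCell n (f '' c) ↔ IsCell n c := by
  obtain ⟨h, -⟩ := exists_homeomorph_image hf hc hinj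
  exact ⟨fun ⟨e⟩ => ⟨e.trans h.symm⟩, fun ⟨e⟩ => ⟨e.trans h⟩⟩

theorem mem_cellBoundary_image_iff {f : S → S} (hf : Continuous f) {c : Set S} (hc : IsCompact c)
    (hinj : InjOn f c) {x : S} (hx : x ∈ c) : f x ∈ cellBoundary (f '' c) ↔ x ∈ cellBoundary c := by
  obtain ⟨h, hh⟩ := exists_homeomorph_image hf hc hinj
  constructor
  · rintro ⟨n, hn, e, u, hu, he⟩
    refine ⟨n, hn, e.trans h.symm, u, hu, ?_⟩
    have : h ⟨x, hx⟩ = e u := Subtype.ext (by rw [hh, he])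
    change ((h.symm (e u) : c) : S) = x
    rw [← this, Homeomorph.symm_apply_apply]
  · rintro ⟨n, hn, e, u, hu, he⟩
    refine ⟨n, hn, e.trans h, u, hu, ?_⟩
    change (h (e u) : S) = f x
    rw [hh, he]

theorem mem_cellInterior_image_iff {f : S → S} (hf : Continuous f) {c : Set S} (hc : IsCompact c)
    (hinj : InjOn f c) {x : S} (hx : x ∈ c) : f x ∈ cellInterior (f '' c) ↔ x ∈ cellInterior c := by
  simp only [cellInterior, Set.mem_sdiff, mem_cellBoundary_image_iff hf hc hinj hx, hx,
    mem_image_of_mem f hx]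

end Image

/-! ### Cell decompositions -/

/-- Every nonempty open set contains an injective continuous image of the plane. -/
def LocallyPlanar (S : Type*) [TopologicalSpace S] : Prop :=
  ∀ U : Set S, IsOpen U → U.Nonempty →
    ∃ j : ℂ → S, Continuous j ∧ Function.Injective j ∧ range j ⊆ U

theorem locallyPlanar_of_orientedSphere (S : Type*) [TopologicalSpace S] [OrientedSphere S] :
    LocallyPlanar S := by
  intro U hU hne
  let φ := OrientedSphere.toRiemannSphere (S := S)
  let i : ℂ → S := fun z => φ.symm (z : OnePoint ℂ)
  have hi : Continuous i := φ.symm.continuous.comp OnePoint.continuous_coe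
  have hinj : Function.Injective i := φ.symm.injective.comp OnePoint.coe_injective
  have hd : DenseRange i := φ.symm.surjective.denseRange.comp OnePoint.denseRange_coe
    φ.symm.continuous
  obtain ⟨z, hz⟩ := hd.exists_mem_open hU hne
  obtain ⟨r, hr, hball⟩ := Metric.isOpen_iff.1 (hU.preimage hi) z hz
  let b := OpenPartialHomeomorph.univBall z r
  have hs : b.source = univ := OpenPartialHomeomorph.univBall_source z r
  refine ⟨i ∘ b, hi.comp (OpenPartialHomeomorph.continuous_univBall z r), hinj.comp ?_, ?_⟩
  · rw [← injOn_univ, ← hs]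
    exact b.injOn
  · rintro _ ⟨w, rfl⟩
    refine hball ?_
    rw [← OpenPartialHomeomorph.univBall_target z hr]
    exact b.map_source (by rw [hs]; trivial)

/-- The union of the members of `D` that are not 2-cells. -/
def skeleton {S : Type*} [TopologicalSpace S] (D : Set (Set S)) : Set S :=
  ⋃₀ {c ∈ D | ¬ IsCell 2 c}

set_option linter.unusedSectionVars false

namespace IsCellDecomposition

variable {S : Type*} [TopologicalSpace S] [CompactSpace S] [T2Space S] {D : Set (Set S)}

theorem isCompact (hD : IsCellDecomposition D) {c : Set S} (hc : c ∈ D) : IsCompact c := by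
  obtain ⟨n, -, h⟩ := hD.isCell c hc
  exact h.isCompact

theorem isClosed (hD : IsCellDecomposition D) {c : Set S} (hc : c ∈ D) : IsClosed c :=
  (hD.isCompact hc).isClosed

theorem finite (hD : IsCellDecomposition D) : D.Finite := by
  choose U hU hfin using hD.locallyFinite
  obtain ⟨t, ht⟩ := CompactSpace.elim_nhds_subcover U hU
  refine (t.finite_toSet.biUnion fun x _ => hfin x).subset fun c hc => ?_
  obtain ⟨n, -, h⟩ := hD.isCell c hc
  obtain ⟨x, hx⟩ := h.nonempty
  have : x ∈ ⋃ y ∈ t, U y := by rw [ht]; trivial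
  simp only [mem_iUnion] at this
  obtain ⟨y, hy, hxy⟩ := this
  simp only [mem_iUnion]
  exact ⟨y, hy, hc, x, hx, hxy⟩

theorem isClosed_sUnion (hD : IsCellDecomposition D) {E : Set (Set S)} (hE : E ⊆ D) :
    IsClosed (⋃₀ E) := by
  rw [sUnion_eq_biUnion]
  exact (hD.finite.subset hE).isClosed_biUnion fun c hc => hD.isClosed (hE hc)

theorem exists_mem (hD : IsCellDecomposition D) (x : S) : ∃ c ∈ D, x ∈ c :=
  mem_sUnion.1 (by rw [hD.sUnion_eq]; trivial)

/-- A minimal cell around `x` has `x` in its interior: otherwise a cell in its boundary would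
contain `x`, and minimality would make the boundary the whole cell. -/
theorem exists_subset_mem_cellInterior (hD : IsCellDecomposition D) {x : S} {c : Set S}
    (hc : c ∈ D) (hx : x ∈ c) : ∃ σ ∈ D, σ ⊆ c ∧ x ∈ cellInterior σ := by
  have hfin : {σ ∈ D | σ ⊆ c ∧ x ∈ σ}.Finite := hD.finite.subset fun σ h => h.1
  obtain ⟨σ, hσ⟩ := hfin.exists_minimal ⟨c, hc, subset_rfl, hx⟩
  obtain ⟨hσD, hσc, hxσ⟩ := hσ.prop
  refine ⟨σ, hσD, hσc, hxσ, fun hb => ?_⟩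
  obtain ⟨n, hn, hcell⟩ := hD.isCell σ hσD
  obtain ⟨E, hE, hEeq⟩ := hD.boundary σ hσD
  obtain ⟨τ, hτE, hxτ⟩ : x ∈ ⋃₀ E := by rwa [← hEeq]
  have hτb : τ ⊆ cellBoundary σ := by rw [hEeq]; exact subset_sUnion_of_mem hτE
  have hτσ : τ ⊆ σ := hτb.trans (cellBoundary_subset σ)
  have := hσ.le_of_le ⟨hE hτE, hτσ.trans hσc, hxτ⟩ hτσ
  exact hcell.cellBoundary_ne hn ((cellBoundary_subset σ).antisymm (this.trans hτb))

theorem eq_of_mem_cellInterior (hD : IsCellDecomposition D) {x : S} {c₁ c₂ : Set S} (h₁ : c₁ ∈ D)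
    (h₂ : c₂ ∈ D) (hx₁ : x ∈ cellInterior c₁) (hx₂ : x ∈ cellInterior c₂) : c₁ = c₂ := by
  by_contra h
  exact disjoint_left.1 (hD.disjoint c₁ h₁ c₂ h₂ h) hx₁ hx₂

theorem subset_of_mem_cellInterior (hD : IsCellDecomposition D) {x : S} {σ c : Set S} (hσ : σ ∈ D)
    (hc : c ∈ D) (hxσ : x ∈ cellInterior σ) (hxc : x ∈ c) : σ ⊆ c := by
  obtain ⟨τ, hτ, hτc, hxτ⟩ := hD.exists_subset_mem_cellInterior hc hxc
  rwa [hD.eq_of_mem_cellInterior hσ hτ hxσ hxτ]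

/-- Every point lies in a smallest cell. -/
theorem exists_carrier (hD : IsCellDecomposition D) (x : S) :
    ∃ σ ∈ D, x ∈ cellInterior σ ∧ ∀ c ∈ D, x ∈ c → σ ⊆ c := by
  obtain ⟨c, hc, hx⟩ := hD.exists_mem x
  obtain ⟨σ, hσ, -, hxσ⟩ := hD.exists_subset_mem_cellInterior hc hx
  exact ⟨σ, hσ, hxσ, fun c hc hx => hD.subset_of_mem_cellInterior hσ hc hxσ hx⟩

theorem isThin (hD : IsCellDecomposition D) {c : Set S} (hc : c ∈ D) (h2 : ¬ IsCell 2 c) :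
    IsThin c := by
  obtain ⟨n, hn, h⟩ := hD.isCell c hc
  refine h.isThin (Nat.le_of_lt_succ (lt_of_le_of_ne hn ?_))
  rintro rfl
  exact h2 h

theorem exists_notMem_skeleton (hD : IsCellDecomposition D) {j : ℂ → S} (hj : Continuous j)
    (hinj : Function.Injective j) : ∃ z, j z ∉ skeleton D :=
  exists_notMem_sUnion_of_isThin (hD.finite.subset fun _ h => h.1) (fun _ h => hD.isClosed h.1)
    (fun _ h => hD.isThin h.1 h.2) hj hinj

theorem cellBoundary_subset_skeleton (hD : IsCellDecomposition D) {X : Set S} (hX : X ∈ D)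
    (h2 : IsCell 2 X) : cellBoundary X ⊆ skeleton D := by
  obtain ⟨E, hE, hEeq⟩ := hD.boundary X hX
  rw [hEeq]
  refine sUnion_subset_sUnion fun c hc => ⟨hE hc, fun hc2 => hc2.not_isThin ?_⟩
  exact h2.isThin_cellBoundary.mono (by rw [hEeq]; exact subset_sUnion_of_mem hc)

/-- A cell that meets the interior of `X` contains all of `X`, so it cannot be thin. -/
theorem cellInterior_disjoint_skeleton (hD : IsCellDecomposition D) {X : Set S} (hX : X ∈ D)
    (h2 : IsCell 2 X) : Disjoint (cellInterior X) (skeleton D) := by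
  rw [disjoint_left]
  rintro x hx ⟨c, ⟨hc, hc2⟩, hxc⟩
  exact h2.not_isThin ((hD.isThin hc hc2).mono (hD.subset_of_mem_cellInterior hX hc hx hxc))

theorem mem_cellInterior_of_notMem_skeleton (hD : IsCellDecomposition D) {x : S} {X : Set S}
    (hX : X ∈ D) (hx : x ∈ X) (hxs : x ∉ skeleton D) : IsCell 2 X ∧ x ∈ cellInterior X := by
  have h2 : IsCell 2 X := by
    by_contra h
    exact hxs ⟨X, ⟨hX, h⟩, hx⟩
  exact ⟨h2, hx, fun hb => hxs (hD.cellBoundary_subset_skeleton hX h2 hb)⟩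

theorem eq_of_notMem_skeleton (hD : IsCellDecomposition D) {x : S} {X Y : Set S}
    (hX : X ∈ D) (hY : Y ∈ D) (hxX : x ∈ X) (hxY : x ∈ Y) (hxs : x ∉ skeleton D) : X = Y :=
  hD.eq_of_mem_cellInterior hX hY (hD.mem_cellInterior_of_notMem_skeleton hX hxX hxs).2
    (hD.mem_cellInterior_of_notMem_skeleton hY hxY hxs).2

/-- No invariance of domain is needed: the interior of a tile is the complement of the union of the
finitely many other cells. -/
theorem isOpen_cellInterior (hD : IsCellDecomposition D) {X : Set S} (hX : X ∈ D)
    (h2 : IsCell 2 X) : IsOpen (cellInterior X) := by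
  have hcl : IsClosed (⋃₀ (D \ {X})) := hD.isClosed_sUnion sdiff_subset
  convert hcl.isOpen_compl using 1
  ext x
  constructor
  · rintro hx ⟨c, ⟨hc, hcX⟩, hxc⟩
    have hxs := disjoint_left.1 (hD.cellInterior_disjoint_skeleton hX h2) hx
    exact hcX (hD.eq_of_notMem_skeleton hc hX hxc hx.1 hxs)
  · intro hx
    obtain ⟨σ, hσ, hxσ, -⟩ := hD.exists_carrier x
    by_cases h : σ = X
    · rwa [← h]
    · exact absurd ⟨σ, ⟨hσ, h⟩, hxσ.1⟩ hx

/-- A connected set that avoids the 1-skeleton lies in the interior of a tile. -/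
theorem exists_subset_cellInterior (hD : IsCellDecomposition D) {K : Set S} (hK : IsPreconnected K)
    (hne : K.Nonempty) (hKs : Disjoint K (skeleton D)) :
    ∃ X ∈ D, IsCell 2 X ∧ K ⊆ cellInterior X := by
  obtain ⟨x, hx⟩ := hne
  obtain ⟨X, hX, hxX⟩ := hD.exists_mem x
  obtain ⟨h2, hxi⟩ := hD.mem_cellInterior_of_notMem_skeleton hX hxX (disjoint_left.1 hKs hx)
  refine ⟨X, hX, h2, ?_⟩
  refine hK.subset_left_of_subset_union (hD.isOpen_cellInterior hX h2) (hD.isClosed hX).isOpen_compl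
    (disjoint_compl_right_iff_subset.2 (cellInterior_subset X)) (fun y hy => ?_) ⟨x, hx, hxi⟩
  by_cases hyX : y ∈ X
  · exact Or.inl (hD.mem_cellInterior_of_notMem_skeleton hX hyX (disjoint_left.1 hKs hy)).2
  · exact Or.inr hyX

/-- The tiles of a cell decomposition of the sphere cover the sphere. -/
theorem exists_tile_mem (hD : IsCellDecomposition D) (hS : LocallyPlanar S) (x : S) :
    ∃ X ∈ D, IsCell 2 X ∧ x ∈ X := by
  by_contra! h
  have hcl : IsClosed (⋃₀ {X ∈ D | IsCell 2 X}) :=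
    hD.isClosed_sUnion fun _ h => h.1
  obtain ⟨j, hj, hinj, hr⟩ := hS _ hcl.isOpen_compl ⟨x, by
    rintro ⟨X, ⟨hX, h2⟩, hx⟩
    exact h X hX h2 hx⟩
  obtain ⟨z, hz⟩ := hD.exists_notMem_skeleton hj hinj
  obtain ⟨X, hX, hzX⟩ := hD.exists_mem (j z)
  exact hr (mem_range_self z)
    ⟨X, ⟨hX, (hD.mem_cellInterior_of_notMem_skeleton hX hzX hz).1⟩, hzX⟩

theorem exists_mem_cellInterior_notMem_skeleton (hD : IsCellDecomposition D) {Y : Set S}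
    (hY : IsCell 2 Y) : ∃ y ∈ cellInterior Y, y ∉ skeleton D := by
  obtain ⟨j, hj, hinj, hr⟩ := hY.exists_plane
  obtain ⟨z, hz⟩ := hD.exists_notMem_skeleton hj hinj
  exact ⟨j z, hr ▸ mem_range_self z, hz⟩

end IsCellDecomposition

/-! ### Sequences of cell decompositions -/

/-- `f` is cellular for `(D (n + 1), D n)` for every `n`, where all `D n` are cell
decompositions. -/
structure IsTower {S : Type*} [TopologicalSpace S] (f : S → S) (D : ℕ → Set (Set S)) : Prop where
  continuous : Continuous f
  decomposition : ∀ n, IsCellDecomposition (D n)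
  cellular : ∀ n, IsCellular f (D (n + 1)) (D n)

namespace IsTower

variable {S : Type*} [TopologicalSpace S] {f : S → S} {D : ℕ → Set (Set S)}

theorem iterate_image_mem (h : IsTower f D) {n k : ℕ} {c : Set S} (hc : c ∈ D (k + n)) :
    f^[n] '' c ∈ D k ∧ InjOn f^[n] c := by
  induction n generalizing c with
  | zero => simpa using hc
  | succ n ih =>
    obtain ⟨h₁, h₂⟩ := h.cellular _ c hc
    obtain ⟨h₃, h₄⟩ := ih h₁
    rw [Function.iterate_succ, image_comp]
    exact ⟨h₃, h₄.comp (injOn_iff_injective.2 h₂.injective) (mapsTo_image f c)⟩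

theorem image_mem (h : IsTower f D) {n k : ℕ} {c : Set S} (hc : c ∈ D (k + n)) :
    f^[n] '' c ∈ D k := (h.iterate_image_mem hc).1

theorem injOn (h : IsTower f D) {n : ℕ} {c : Set S} (hc : c ∈ D n) {m : ℕ} (hm : m ≤ n) :
    InjOn f^[m] c := by
  obtain ⟨k, rfl⟩ := Nat.exists_eq_add_of_le' hm
  exact (h.iterate_image_mem hc).2

variable [T2Space S]

theorem isCell_image_iff (h : IsTower f D) {n : ℕ} {c : Set S} (hc : c ∈ D n) {m : ℕ} (hm : m ≤ n)
    {d : ℕ} : IsCell d (f^[m] '' c) ↔ IsCell d c := by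
  obtain ⟨l, -, hl⟩ := (h.decomposition n).isCell c hc
  exact ThurstonMap.isCell_image_iff (h.continuous.iterate m) hl.isCompact (h.injOn hc hm)

theorem mem_cellInterior_image_iff (h : IsTower f D) {n : ℕ} {c : Set S} (hc : c ∈ D n) {m : ℕ}
    (hm : m ≤ n) {x : S} (hx : x ∈ c) :
    f^[m] x ∈ cellInterior (f^[m] '' c) ↔ x ∈ cellInterior c := by
  obtain ⟨l, -, hl⟩ := (h.decomposition n).isCell c hc
  exact ThurstonMap.mem_cellInterior_image_iff (h.continuous.iterate m) hl.isCompact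
    (h.injOn hc hm) hx

end IsTower

/-! ### Stars and the comparison of diameters -/

/-- The points all of whose cells contain `v`. -/
def star {S : Type*} (D : Set (Set S)) (v : S) : Set S := {x | ∀ c ∈ D, x ∈ c → v ∈ c}

section Star

variable {S : Type*} [TopologicalSpace S] [CompactSpace S] [T2Space S]

theorem IsCellDecomposition.isOpen_star {D : Set (Set S)} (hD : IsCellDecomposition D) (v : S) :
    IsOpen (star D v) := by
  convert (hD.isClosed_sUnion (E := {c ∈ D | v ∉ c}) fun _ h => h.1).isOpen_compl using 1
  ext x
  constructor
  · rintro hx ⟨c, ⟨hc, hv⟩, hxc⟩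
    exact hv (hx c hc hxc)
  · intro hx c hc hxc
    by_contra hv
    exact hx ⟨c, ⟨hc, hv⟩, hxc⟩

/-- A connected set that an iterate maps into a star of level `0` lies in a star. -/
theorem IsTower.exists_subset_star {f : S → S} {D : ℕ → Set (Set S)} (h : IsTower f D) {n : ℕ}
    {K : Set S} (hK : IsPreconnected K) (hne : K.Nonempty) {v : S}
    (hKv : MapsTo f^[n] K (star (D 0) v)) : ∃ w, K ⊆ star (D n) w := by
  have hD := h.decomposition n
  -- The image of the smallest cell around `x` contains `v`; a preimage `w` of `v` in that cell lies
  -- in every cell around `x`.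
  have key : ∀ x ∈ K, ∃ w, f^[n] w = v ∧ x ∈ star (D n) w := by
    intro x hx
    obtain ⟨σ, hσ, hxσ, hmin⟩ := hD.exists_carrier x
    obtain ⟨w, hw, hwv⟩ := hKv hx _ (h.image_mem (k := 0) (by simpa using hσ))
      (mem_image_of_mem _ hxσ.1)
    exact ⟨w, hwv, fun c hc hxc => hmin c hc hxc hw⟩
  obtain ⟨x₀, hx₀⟩ := hne
  obtain ⟨w₀, hw₀, hxw₀⟩ := key x₀ hx₀
  -- Stars at distinct preimages of `v` are open and disjoint, since `f^[n]` is injective on each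
  -- `n`-cell; a connected set stays in one.
  refine ⟨w₀, hK.subset_left_of_subset_union (v := ⋃ w ∈ {w | f^[n] w = v ∧ w ≠ w₀}, star (D n) w)
    (hD.isOpen_star w₀) (isOpen_biUnion fun w _ => hD.isOpen_star w) ?_ ?_ ⟨x₀, hx₀, hxw₀⟩⟩
  · rw [disjoint_left]
    intro x hx hx'
    simp only [mem_iUnion] at hx'
    obtain ⟨w, ⟨hw, hne⟩, hxw⟩ := hx'
    obtain ⟨c, hc, hxc⟩ := hD.exists_mem x
    exact hne (h.injOn hc le_rfl (hxw c hc hxc) (hx c hc hxc) (hw.trans hw₀.symm))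
  · intro x hx
    obtain ⟨w, hw, hxw⟩ := key x hx
    by_cases hww : w = w₀
    · exact Or.inl (hww ▸ hxw)
    · refine Or.inr ?_
      simp only [mem_iUnion]
      exact ⟨w, ⟨hw, hww⟩, hxw⟩

end Star

section Metric

variable {S : Type*} [MetricSpace S] [CompactSpace S]

theorem IsCellDecomposition.dist_le_of_mem_star (hS : LocallyPlanar S) {D : Set (Set S)}
    (hD : IsCellDecomposition D) {ε : ℝ} (hε : ∀ X ∈ D, IsCell 2 X → Metric.diam X ≤ ε) {w x y : S}
    (hx : x ∈ star D w) (hy : y ∈ star D w) : dist x y ≤ 2 * ε := by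
  have key : ∀ x ∈ star D w, dist x w ≤ ε := by
    intro x hx
    obtain ⟨X, hX, h2, hxX⟩ := hD.exists_tile_mem hS x
    exact (Metric.dist_le_diam_of_mem (hD.isCompact hX).isBounded hxX (hx X hX hxX)).trans
      (hε X hX h2)
  linarith [dist_triangle_right x y w, key x hx, key y hy]

/-- The number of steps in the chain depends only on the cell `c` of level 0. -/
theorem IsTower.exists_dist_le (hS : LocallyPlanar S) {f : S → S} {D D' : ℕ → Set (Set S)}
    (h : IsTower f D) (h' : IsTower f D') {c : Set S} (hc : c ∈ D 0) :
    ∃ M : ℕ, ∀ (n : ℕ) (ε : ℝ), (∀ X ∈ D' n, IsCell 2 X → Metric.diam X ≤ ε) →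
      ∀ X ∈ D n, f^[n] '' X = c → ∀ x ∈ X, ∀ y ∈ X, dist x y ≤ M * (2 * ε) := by
  obtain ⟨m, -, ⟨e⟩⟩ := (h.decomposition 0).isCell c hc
  have : CompactSpace (UnitBall m) := isCompact_iff_compactSpace.1 (isCompact_closedBall _ _)
  obtain ⟨δ, hδ, hleb⟩ := lebesgue_number_lemma_of_metric (s := (univ : Set (UnitBall m)))
    (c := fun v : S => {u | (e u : S) ∈ star (D' 0) v}) isCompact_univ
    (fun v => ((h'.decomposition 0).isOpen_star v).preimage (by fun_prop))
    (fun u _ => mem_iUnion.2 ⟨e u, fun c _ hx => hx⟩)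
  -- The path `γ` below is 2-Lipschitz, so in time `1 / M` it moves less than the Lebesgue number
  -- `δ`.
  obtain ⟨M, hM⟩ := exists_nat_gt (2 / δ)
  have hM0 : (0 : ℝ) < M := lt_trans (by positivity) hM
  refine ⟨M, fun n ε hε X hX hXc x hx y hy => ?_⟩
  subst hXc
  obtain ⟨g, hg⟩ := exists_homeomorph_image (h.continuous.iterate n)
    ((h.decomposition n).isCompact hX) (h.injOn hX le_rfl)
  set a := e.symm (g ⟨x, hx⟩)
  set b := e.symm (g ⟨y, hy⟩)
  let pr : ℝ → unitInterval := projIcc 0 1 zero_le_one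
  have hmem : ∀ t : ℝ, AffineMap.lineMap (a : EuclideanSpace ℝ (Fin m)) b (pr t : ℝ) ∈ UnitBall m :=
    fun t => (convex_closedBall _ _).lineMap_mem a.2 b.2 (pr t).2
  let γ : ℝ → UnitBall m := fun t => ⟨_, hmem t⟩
  have hdist : ∀ s t, dist (γ s) (γ t) ≤ 2 * |s - t| := by
    intro s t
    have h1 : dist (pr s) (pr t) ≤ dist s t := by
      simpa using (LipschitzWith.projIcc (zero_le_one (α := ℝ))).dist_le_mul s t
    have h2 : dist (a : EuclideanSpace ℝ (Fin m)) b ≤ 2 := by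
      have := dist_triangle_right (a : EuclideanSpace ℝ (Fin m)) b 0
      linarith [Metric.mem_closedBall.1 a.2, Metric.mem_closedBall.1 b.2]
    rw [Subtype.dist_eq, dist_lineMap_lineMap, mul_comm]
    exact mul_le_mul h2 h1 dist_nonneg zero_le_two
  have hγ : Continuous γ := by
    refine Continuous.subtype_mk ?_ _
    have : Continuous pr := continuous_projIcc
    fun_prop
  -- The segment between the parameters of `f^[n] x` and `f^[n] y`, lifted to a path in `X` from `x`
  -- to `y`.
  let P : ℝ → S := fun t => g.symm (e (γ t))
  have hP : Continuous P := by fun_prop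
  have hstep : ∀ i : ℕ, dist (P (i / M)) (P ((i + 1 : ℕ) / M)) ≤ 2 * ε := by
    intro i
    obtain ⟨v, hv⟩ := hleb (γ (i / M)) trivial
    have hmem_left : ((i : ℝ) / M) ∈ Icc ((i : ℝ) / M) ((i + 1 : ℕ) / M) :=
      ⟨le_rfl, by gcongr; simp⟩
    have hmem_right : (((i + 1 : ℕ) : ℝ) / M) ∈ Icc ((i : ℝ) / M) ((i + 1 : ℕ) / M) :=
      ⟨by gcongr; simp, le_rfl⟩
    obtain ⟨w, hw⟩ := h'.exists_subset_star (n := n) (v := v)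
      (K := P '' Icc ((i : ℝ) / M) ((i + 1 : ℕ) / M)) (isPreconnected_Icc.image P hP.continuousOn)
      (Nonempty.image _ ⟨_, hmem_left⟩) (by
        rintro _ ⟨t, ht, rfl⟩
        have : f^[n] (P t) = e (γ t) := by rw [← hg]; simp
        rw [this]
        refine hv ?_
        rw [Metric.mem_ball]
        refine (hdist _ _).trans_lt ?_
        have h1 : |t - i / M| ≤ 1 / M := by
          rw [abs_of_nonneg (sub_nonneg.2 ht.1), sub_le_iff_le_add]
          refine ht.2.trans_eq ?_
          push_cast; ring
        rw [div_lt_iff₀ hδ] at hM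
        calc 2 * |t - i / M| ≤ 2 * (1 / M) := by gcongr
          _ < δ := by rw [mul_one_div, div_lt_iff₀ hM0, mul_comm]; exact hM)
    exact (h'.decomposition n).dist_le_of_mem_star hS hε (hw (mem_image_of_mem P hmem_left))
      (hw (mem_image_of_mem P hmem_right))
  have hsum := dist_le_range_sum_of_dist_le (f := fun i : ℕ => P (i / M)) (d := fun _ => 2 * ε) M
    fun {i} _ => hstep i
  have h0 : P ((0 : ℕ) / M) = x := by
    simp [P, γ, pr, a]
  have h1 : P ((M : ℕ) / M) = y := by
    rw [div_self hM0.ne']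
    simp [P, γ, pr, b]
  rw [h0, h1] at hsum
  simpa using hsum

/-- If the tiles of one sequence of cell decompositions shrink, then the cells of every other one
shrink, too. -/
theorem IsTower.eventually_diam_lt (hS : LocallyPlanar S) {f : S → S} {D D' : ℕ → Set (Set S)}
    (h : IsTower f D) (h' : IsTower f D')
    (hexp : ∀ ε > 0, ∀ᶠ n in atTop, ∀ X ∈ D' n, IsCell 2 X → Metric.diam X ≤ ε) {ε : ℝ}
    (hε : 0 < ε) : ∀ᶠ n in atTop, ∀ X ∈ D n, Metric.diam X < ε := by
  have key : ∀ c ∈ D 0, ∀ᶠ n in atTop, ∀ X ∈ D n, f^[n] '' X = c → Metric.diam X < ε := by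
    intro c hc
    obtain ⟨M, hM⟩ := h.exists_dist_le hS h' hc
    -- The summand `1` makes the final bound strict and covers `M = 0`.
    filter_upwards [hexp (ε / (2 * (M + 1))) (by positivity)] with n hn X hX hXc
    refine (Metric.diam_le_of_forall_dist_le (by positivity) (hM n _ hn X hX hXc)).trans_lt ?_
    have : (M : ℝ) * (2 * (ε / (2 * (M + 1)))) = ε * (M / (M + 1)) := by field_simp
    rw [this]
    refine mul_lt_of_lt_one_right hε ?_
    rw [div_lt_one (by positivity)]
    linarith
  filter_upwards [((h.decomposition 0).finite.eventually_all).2 key] with n hn X hX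
  exact hn _ (h.image_mem (k := 0) (by simpa using hX)) X hX rfl

end Metric

/-! ### Refinement and pull-backs of tiles -/

namespace IsTower

variable {S : Type*} [TopologicalSpace S] [CompactSpace S] [T2Space S] {f : S → S}
  {D : ℕ → Set (Set S)}

/-- On each `n`-cell, `f^[n]` preserves the dimension and the interior, and interiors of tiles avoid
the skeleton. -/
theorem mem_skeleton_iff (h : IsTower f D) {n : ℕ} {x : S} :
    f^[n] x ∈ skeleton (D 0) ↔ x ∈ skeleton (D n) := by
  constructor
  · intro hx
    by_contra hxs
    obtain ⟨X, hX, hxX⟩ := (h.decomposition n).exists_mem x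
    obtain ⟨h2, hxi⟩ := (h.decomposition n).mem_cellInterior_of_notMem_skeleton hX hxX hxs
    exact disjoint_left.1 ((h.decomposition 0).cellInterior_disjoint_skeleton
      (h.image_mem (k := 0) (by simpa using hX)) ((h.isCell_image_iff hX le_rfl).2 h2))
      ((h.mem_cellInterior_image_iff hX le_rfl hxX).2 hxi) hx
  · rintro ⟨c, ⟨hc, h2⟩, hx⟩
    exact ⟨f^[n] '' c, ⟨h.image_mem (k := 0) (by simpa using hc),
      fun h' => h2 ((h.isCell_image_iff hc le_rfl).1 h')⟩, mem_image_of_mem _ hx⟩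

variable (h : IsTower f D) (hinv : MapsTo f (skeleton (D 0)) (skeleton (D 0)))
include h hinv

/-- The skeleton of level `n` is the preimage of that of level `0` under `f^[n]`. Only here is the
invariance `hinv` applied directly. -/
theorem skeleton_mono : Monotone fun n => skeleton (D n) := by
  refine monotone_nat_of_le_succ fun n x hx => ?_
  rw [← h.mem_skeleton_iff] at hx ⊢
  rw [Function.iterate_succ_apply']
  exact hinv hx

/-- The interior of `X` is connected and avoids the coarser skeleton, so it lies in one coarser
tile; then take closures. -/
theorem exists_tile_superset {m n : ℕ} (hmn : m ≤ n) {X : Set S} (hX : X ∈ D n)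
    (h2 : IsCell 2 X) : ∃ Y ∈ D m, IsCell 2 Y ∧ X ⊆ Y := by
  obtain ⟨Y, hY, hY2, hXY⟩ := (h.decomposition m).exists_subset_cellInterior
    h2.isPreconnected_cellInterior h2.cellInterior_nonempty
    (((h.decomposition n).cellInterior_disjoint_skeleton hX h2).mono_right
      (h.skeleton_mono hinv hmn))
  exact ⟨Y, hY, hY2, h2.subset_closure_cellInterior.trans (closure_minimal
    (hXY.trans (cellInterior_subset Y)) ((h.decomposition m).isClosed hY))⟩

/-- A tile `Y` in the image of an `n`-cell `X` under `f^[n]` can be pulled back to a tile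
in `X`. -/
theorem exists_pullback (hS : LocallyPlanar S) {n k : ℕ} {X Y : Set S} (hX : X ∈ D n)
    (hY : Y ∈ D k) (hY2 : IsCell 2 Y) (hsub : Y ⊆ f^[n] '' X) :
    ∃ Z ∈ D (k + n), IsCell 2 Z ∧ Z ⊆ X ∧ f^[n] '' Z = Y := by
  obtain ⟨y, hy⟩ := hY2.cellInterior_nonempty
  obtain ⟨x, hxX, rfl⟩ := hsub (cellInterior_subset Y hy)
  have hys := disjoint_left.1 ((h.decomposition k).cellInterior_disjoint_skeleton hY hY2) hy
  -- As `x` is off the `n`-skeleton, `X` is the only `n`-cell around `x`, so a finer tile around `x`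
  -- must lie in `X`.
  have hxs : x ∉ skeleton (D n) := fun hxs =>
    hys (h.skeleton_mono hinv (Nat.zero_le k) (h.mem_skeleton_iff.2 hxs))
  obtain ⟨Z, hZ, hZ2, hxZ⟩ := (h.decomposition (k + n)).exists_tile_mem hS x
  obtain ⟨X', hX', -, hZX'⟩ := h.exists_tile_superset hinv (Nat.le_add_left n k) hZ hZ2
  have hXX' : X' = X := (h.decomposition n).eq_of_notMem_skeleton hX' hX (hZX' hxZ) hxX hxs
  subst hXX'
  exact ⟨Z, hZ, hZ2, hZX', (h.decomposition k).eq_of_notMem_skeleton (h.image_mem hZ) hY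
    (mem_image_of_mem _ hxZ) (cellInterior_subset Y hy) hys⟩

end IsTower

/-! ### The cells of level 0 -/

theorem locallyConnectedSpace_of_orientedSphere (S : Type*) [TopologicalSpace S]
    [OrientedSphere S] : LocallyConnectedSpace S := by
  have : LocallyConnectedSpace (Metric.sphere (0 : EuclideanSpace ℝ (Fin 3)) 1) :=
    ChartedSpace.locallyConnectedSpace (EuclideanSpace ℝ (Fin 2)) _
  let φ := (OrientedSphere.toRiemannSphere (S := S)).trans
    (onePointEquivSphereOfFinrankEq (V := ℂ) (ι := Fin 3) (by simp))
  exact φ.isOpenEmbedding.locallyConnectedSpace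

section ZeroCells

set_option linter.unusedSectionVars false

variable {S : Type*} [TopologicalSpace S] [OrientedSphere S] [T2Space S] {f : S → S} {C : Set S}

theorem IsJordanCurve.isThin (hC : IsJordanCurve C) : IsThin C := by
  obtain ⟨e⟩ := hC
  exact ⟨e.symm, e.symm.continuous, e.symm.injective⟩

theorem IsJordanCurve.isClosed (hC : IsJordanCurve C) : IsClosed C := by
  obtain ⟨e⟩ := hC
  exact (isCompact_iff_compactSpace.2 e.compactSpace).isClosed

theorem not_isThin_of_mem_zeroTiles (hC : IsJordanCurve C) {X : Set S} (hX : X ∈ zeroTiles C) :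
    ¬ IsThin X := by
  obtain ⟨x, hx, rfl⟩ := hX
  have := locallyConnectedSpace_of_orientedSphere S
  obtain ⟨j, hj, hinj, hr⟩ := locallyPlanar_of_orientedSphere S _
    (hC.isClosed.isOpen_compl.connectedComponentIn (x := x)) ⟨x, mem_connectedComponentIn hx⟩
  exact not_isThin_of_ball hj hinj (c := 0) one_pos fun z _ =>
    subset_closure (hr (mem_range_self z))

theorem mem_zeroTiles_or_subset (hC : IsJordanCurve C) (hpost : post f ⊆ C) {c : Set S}
    (hc : c ∈ zeroCells f C) : c ∈ zeroTiles C ∨ c ⊆ C := by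
  rcases hc with (hc | ⟨x, hx, rfl⟩) | ⟨x, hx, rfl⟩
  · exact Or.inl hc
  · exact Or.inr (closure_minimal
      ((connectedComponentIn_subset _ _).trans sdiff_subset) hC.isClosed)
  · exact Or.inr (singleton_subset_iff.2 (hpost hx))

variable (hC : IsJordanCurve C) (hpost : post f ⊆ C)
include hC hpost

/-- A 0-tile contains a nonempty open set, so it is not thin and must have dimension 2; all other
0-cells lie in the thin set `C`. -/
theorem mem_zeroTiles_iff (hD : IsCellDecomposition (zeroCells f C)) {X : Set S} :
    X ∈ zeroTiles C ↔ X ∈ zeroCells f C ∧ IsCell 2 X := by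
  constructor
  · intro hX
    have hX0 : X ∈ zeroCells f C := Or.inl (Or.inl hX)
    refine ⟨hX0, ?_⟩
    by_contra h2
    obtain ⟨n, hn, h⟩ := hD.isCell X hX0
    refine not_isThin_of_mem_zeroTiles hC hX (h.isThin (Nat.le_of_lt_succ (lt_of_le_of_ne hn ?_)))
    rintro rfl
    exact h2 h
  · rintro ⟨hX, h2⟩
    exact (mem_zeroTiles_or_subset hC hpost hX).resolve_right fun h =>
      h2.not_isThin (hC.isThin.mono h)

/-- Turns the hypothesis `f(C) ⊆ C` into invariance of the skeleton of level 0. -/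
theorem skeleton_zeroCells (hD : IsCellDecomposition (zeroCells f C)) :
    skeleton (zeroCells f C) = C := by
  ext y
  constructor
  · rintro ⟨c, ⟨hc, h2⟩, hy⟩
    refine (mem_zeroTiles_or_subset hC hpost hc).resolve_left (fun h => h2 ?_) hy
    exact ((mem_zeroTiles_iff hC hpost hD).1 h).2
  · intro hy
    have key : ∃ c ∈ zeroCells f C, c ⊆ C ∧ y ∈ c := by
      by_cases hyp : y ∈ post f
      · exact ⟨{y}, Or.inr ⟨y, hyp, rfl⟩, singleton_subset_iff.2 hy, rfl⟩
      · exact ⟨_, Or.inl (Or.inr ⟨y, ⟨hy, hyp⟩, rfl⟩), closure_minimal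
          ((connectedComponentIn_subset _ _).trans sdiff_subset) hC.isClosed,
          subset_closure (mem_connectedComponentIn ⟨hy, hyp⟩)⟩
    obtain ⟨c, hc, hcC, hyc⟩ := key
    exact ⟨c, ⟨hc, fun h2 => h2.not_isThin (hC.isThin.mono hcC)⟩, hyc⟩

end ZeroCells

/-! ### Transitivity and dense orbits -/

/-- By transitivity, the points that visit a given basic open set form a dense open set; Baire gives
a point that visits all of them. -/
theorem TopTransitive.hasDenseForwardOrbit {X : Type*} [TopologicalSpace X] [BaireSpace X]
    [SecondCountableTopology X] [Nonempty X] {T : X → X} (hT : Continuous T)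
    (h : TopTransitive T) : HasDenseForwardOrbit T := by
  let B := TopologicalSpace.countableBasis X
  have hB := TopologicalSpace.isBasis_countableBasis X
  have : Countable B := (TopologicalSpace.countable_countableBasis X).to_subtype
  have hopen : ∀ V : B, IsOpen (⋃ n : ℕ, T^[n] ⁻¹' (V : Set X)) := fun V =>
    isOpen_iUnion fun n => (hB.isOpen V.2).preimage (hT.iterate n)
  have hdense : ∀ V : B, Dense (⋃ n : ℕ, T^[n] ⁻¹' (V : Set X)) := by
    intro V
    rw [dense_iff_inter_open]
    intro U hU hUne
    obtain ⟨n, _, ⟨x, hxU, rfl⟩, hxV⟩ := h U V hU (hB.isOpen V.2) hUne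
      (TopologicalSpace.nonempty_of_mem_countableBasis V.2)
    exact ⟨x, hxU, mem_iUnion.2 ⟨n, hxV⟩⟩
  obtain ⟨x, hx⟩ := (dense_iInter_of_isOpen hopen hdense).nonempty
  refine ⟨x, hB.dense_iff.2 fun V hV _ => ?_⟩
  obtain ⟨n, hn⟩ := mem_iUnion.1 (mem_iInter.1 hx ⟨V, hV⟩)
  exact ⟨T^[n] x, hn, mem_range_self n⟩

/-! ### Tiles that survive under the restriction of `f` to a union of 1-tiles -/

/-- The points whose first `n` iterates exist for `f` restricted to `s`, the last one lying in the
image of `s`. -/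
def survivors {S : Type*} (f : S → S) (s : Set S) (n : ℕ) : Set S :=
  {x | (∀ i < n, f^[i] x ∈ s) ∧ f^[n] x ∈ f '' s}

/-- The 2-cells in `D n` that consist of survivors. -/
def survivingTiles {S : Type*} [TopologicalSpace S] (f : S → S) (D : ℕ → Set (Set S)) (s : Set S)
    (n : ℕ) : Set (Set S) :=
  {X ∈ D n | IsCell 2 X ∧ X ⊆ survivors f s n}

/-- The intersection over all levels `n ≥ 1` of the unions of the surviving tiles. -/
def survivingLimit {S : Type*} [TopologicalSpace S] (f : S → S) (D : ℕ → Set (Set S)) (s : Set S) :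
    Set S :=
  ⋂ n : ℕ, ⋂ _ : 1 ≤ n, ⋃₀ survivingTiles f D s n

theorem mem_survivingLimit {S : Type*} [TopologicalSpace S] {f : S → S} {D : ℕ → Set (Set S)}
    {s : Set S} {x : S} :
    x ∈ survivingLimit f D s ↔ ∀ n, 1 ≤ n → ∃ X ∈ survivingTiles f D s n, x ∈ X := by
  simp [survivingLimit]

theorem mem_of_mem_survivingLimit {S : Type*} [TopologicalSpace S] {f : S → S}
    {D : ℕ → Set (Set S)} {s : Set S} {x : S} (hx : x ∈ survivingLimit f D s) : x ∈ s := by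
  obtain ⟨X, hX, hxX⟩ := mem_survivingLimit.1 hx 1 le_rfl
  exact (hX.2.2 hxX).1 0 zero_lt_one

theorem mem_survivors_add {S : Type*} {f : S → S} {s : Set S} {n k : ℕ} {x : S}
    (h₁ : ∀ i < n, f^[i] x ∈ s) (h₂ : f^[n] x ∈ survivors f s k) : x ∈ survivors f s (k + n) := by
  refine ⟨fun i hi => ?_, ?_⟩
  · rcases lt_or_ge i n with hin | hin
    · exact h₁ i hin
    · obtain ⟨m, rfl⟩ := Nat.exists_eq_add_of_le' hin
      rw [Function.iterate_add_apply]
      exact h₂.1 m (by omega)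
  · rw [Function.iterate_add_apply]
    exact h₂.2

namespace IsTower

variable {S : Type*} [TopologicalSpace S] {f : S → S} {D : ℕ → Set (Set S)} {s : Set S}

theorem apply_mem_survivingLimit [T2Space S] (h : IsTower f D) {x : S}
    (hx : x ∈ survivingLimit f D s) : f x ∈ survivingLimit f D s := by
  rw [mem_survivingLimit] at hx ⊢
  intro n hn
  obtain ⟨X, ⟨hX, h2, hXs⟩, hxX⟩ := hx (n + 1) (by omega)
  have hc := h.isCell_image_iff hX (m := 1) (by omega) (d := 2)
  rw [Function.iterate_one] at hc
  refine ⟨f '' X, ⟨(h.cellular n X hX).1, hc.2 h2, ?_⟩, mem_image_of_mem f hxX⟩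
  rintro _ ⟨z, hz, rfl⟩
  refine ⟨fun i hi => ?_, ?_⟩
  · rw [← Function.iterate_succ_apply]
    exact (hXs hz).1 (i + 1) (by omega)
  · rw [← Function.iterate_succ_apply]
    exact (hXs hz).2

variable [CompactSpace S] [T2Space S] (h : IsTower f D)
  (hinv : MapsTo f (skeleton (D 0)) (skeleton (D 0)))
include h hinv

theorem exists_survivingTile_pullback (hS : LocallyPlanar S) {n k : ℕ} {X Y : Set S}
    (hX : X ∈ survivingTiles f D s n) (hY : Y ∈ survivingTiles f D s k) (hsub : Y ⊆ f^[n] '' X) :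
    ∃ Z ∈ survivingTiles f D s (k + n), Z ⊆ X ∧ f^[n] '' Z = Y := by
  obtain ⟨Z, hZ, hZ2, hZX, hZY⟩ := h.exists_pullback hinv hS hX.1 hY.1 hY.2.1 hsub
  refine ⟨Z, ⟨hZ, hZ2, fun z hz => ?_⟩, hZX, hZY⟩
  exact mem_survivors_add (hX.2.2 (hZX hz)).1 (hY.2.2 (hZY ▸ mem_image_of_mem _ hz))

variable (hs : ∃ 𝔛 ⊆ {X ∈ D 1 | IsCell 2 X}, s = ⋃₀ 𝔛)
include hs

theorem sUnion_survivingTiles_succ_subset {n : ℕ} (hn : 1 ≤ n) :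
    ⋃₀ survivingTiles f D s (n + 1) ⊆ ⋃₀ survivingTiles f D s n := by
  rintro x ⟨X, ⟨hX, h2, hXs⟩, hx⟩
  obtain ⟨Y, hY, hY2, hXY⟩ := h.exists_tile_superset hinv (Nat.le_succ n) hX h2
  -- Since `i < n`, the tile `f^[i] '' Y` lies in a 1-tile `W`. Its part `f^[i] '' X` lies in `s`
  -- and has a point off the 1-skeleton, which forces `W` to be one of the 1-tiles that make up `s`.
  have key : ∀ i < n, f^[i] '' Y ⊆ s := by
    intro i hi
    obtain ⟨𝔛, h𝔛, rfl⟩ := hs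
    obtain ⟨m, rfl⟩ : ∃ m, n = (m + 1) + i := ⟨n - i - 1, by omega⟩
    obtain ⟨W, hW, -, hYW⟩ := h.exists_tile_superset hinv (m := 1) (by omega)
      (h.image_mem hY) ((h.isCell_image_iff hY (by omega)).2 hY2)
    obtain ⟨w, hw, hws⟩ := (h.decomposition 1).exists_mem_cellInterior_notMem_skeleton
      ((h.isCell_image_iff hX (m := i) (by omega)).2 h2)
    obtain ⟨z, hz, rfl⟩ := cellInterior_subset _ hw
    obtain ⟨Z, hZ, hzZ⟩ := (hXs hz).1 i (by omega)
    have hWZ : W = Z := (h.decomposition 1).eq_of_notMem_skeleton hW (h𝔛 hZ).1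
      (hYW (mem_image_of_mem _ (hXY hz))) hzZ hws
    rw [hWZ] at hYW
    exact hYW.trans (subset_sUnion_of_mem hZ)
  refine ⟨Y, ⟨hY, hY2, fun y hy => ⟨fun i hi => key i hi (mem_image_of_mem _ hy), ?_⟩⟩, hXY hx⟩
  -- Here `n ≥ 1` is essential: `f^[n] y` is in `f '' s` because the previous iterate is in `s`.
  obtain ⟨m, rfl⟩ := Nat.exists_eq_add_of_le' hn
  rw [Function.iterate_succ_apply']
  exact mem_image_of_mem f (key m (by omega) (mem_image_of_mem _ hy))

theorem sUnion_survivingTiles_subset {m n : ℕ} (hm : 1 ≤ m) (hmn : m ≤ n) :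
    ⋃₀ survivingTiles f D s n ⊆ ⋃₀ survivingTiles f D s m := by
  induction n, hmn using Nat.le_induction with
  | base => exact subset_rfl
  | succ n hmn ih =>
    exact (h.sUnion_survivingTiles_succ_subset hinv hs (hm.trans hmn)).trans ih

theorem mem_survivingLimit_of_frequently {x : S}
    (hx : ∃ᶠ n in atTop, ∃ X ∈ survivingTiles f D s n, x ∈ X) : x ∈ survivingLimit f D s := by
  rw [mem_survivingLimit]
  intro m hm
  obtain ⟨n, hmn, hn⟩ := frequently_atTop.1 hx m
  exact h.sUnion_survivingTiles_subset hinv hs hm hmn hn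

omit hs in
/-- Every point of the limit set lies in a 0-tile that contains surviving tiles around the point
of arbitrarily high level. -/
theorem exists_zeroTile_frequently {y : S} (hy : y ∈ survivingLimit f D s) :
    ∃ B ∈ D 0, IsCell 2 B ∧ ∃ᶠ k in atTop, ∃ Y ∈ survivingTiles f D s k, y ∈ Y ∧ Y ⊆ B := by
  by_contra! hcon
  have key : ∀ B ∈ D 0, ∀ᶠ k in atTop, IsCell 2 B →
      ∀ Y ∈ survivingTiles f D s k, y ∈ Y → ¬ Y ⊆ B := by
    intro B hB
    by_cases hB2 : IsCell 2 B
    · filter_upwards [hcon B hB hB2] with k hk _ using hk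
    · exact Eventually.of_forall fun k h => absurd h hB2
  -- Pigeonhole: there are finitely many 0-cells, so a single large level `k` would be bad for all
  -- of them.
  obtain ⟨k, hk, hk1⟩ := ((((h.decomposition 0).finite.eventually_all).2 key).and
    (eventually_ge_atTop 1)).exists
  obtain ⟨Y, hY, hyY⟩ := mem_survivingLimit.1 hy k hk1
  obtain ⟨B, hB, hB2, hYB⟩ := h.exists_tile_superset hinv (Nat.zero_le k) hY.1 hY.2.1
  exact hk B hB hB2 Y hY hyY hYB

/-- The pull-back `Z` of `T` is mapped bijectively onto `B` by `f^[l + n]`. Hence the pull-backs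
into `Z` of all tiles around `y` contain the one preimage of `y` in `Z`, which therefore survives at
arbitrarily high levels. -/
theorem exists_mem_survivingLimit_iterate_eq (hS : LocallyPlanar S) {n l : ℕ} {X T B : Set S}
    {y : S} (hX : X ∈ survivingTiles f D s n) (hT : T ∈ survivingTiles f D s l)
    (hTX : T ⊆ f^[n] '' X) (hTB : f^[l] '' T = B)
    (hy : ∃ᶠ k in atTop, ∃ Y ∈ survivingTiles f D s k, y ∈ Y ∧ Y ⊆ B) :
    ∃ x ∈ X, x ∈ survivingLimit f D s ∧ f^[l + n] x = y := by
  obtain ⟨Z, hZ, hZX, hZT⟩ := h.exists_survivingTile_pullback hinv hS hX hT hTX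
  have hZB : f^[l + n] '' Z = B := by
    rw [Function.iterate_add, image_comp, hZT, hTB]
  obtain ⟨x, hxZ, hxy⟩ : y ∈ f^[l + n] '' Z := by
    obtain ⟨k, Y, -, hyY, hYB⟩ := hy.exists
    rw [hZB]
    exact hYB hyY
  refine ⟨x, hZX hxZ, h.mem_survivingLimit_of_frequently hinv hs ?_, hxy⟩
  refine frequently_atTop.2 fun a => ?_
  obtain ⟨k, hak, Y, hY, hyY, hYB⟩ := frequently_atTop.1 hy a
  obtain ⟨W, hW, hWZ, hWY⟩ := h.exists_survivingTile_pullback hinv hS hZ hY (hZB ▸ hYB)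
  obtain ⟨w, hw, hwy⟩ : y ∈ f^[l + n] '' W := hWY ▸ hyY
  have : w = x := h.injOn hZ.1 le_rfl (hWZ hw) hxZ (hwy.trans hxy.symm)
  exact ⟨k + (l + n), by omega, W, hW, this ▸ hw⟩

/-- Repeated pull-back through `X` yields surviving tiles of unbounded level, so the limit set is a
decreasing intersection of nonempty compact sets. -/
theorem survivingLimit_nonempty (hS : LocallyPlanar S) {n : ℕ} (hn : 1 ≤ n) {X : Set S}
    (hX : X ∈ survivingTiles f D s n) (hsub : X ⊆ f^[n] '' X) :
    (survivingLimit f D s).Nonempty := by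
  have key : ∀ j : ℕ, ∃ m ≥ j, ∃ Y ∈ survivingTiles f D s m, Y ⊆ X := by
    intro j
    induction j with
    | zero => exact ⟨n, Nat.zero_le n, X, hX, subset_rfl⟩
    | succ j ih =>
      obtain ⟨m, hm, Y, hY, hYX⟩ := ih
      obtain ⟨Z, hZ, hZX, -⟩ := h.exists_survivingTile_pullback hinv hS hX hY (hYX.trans hsub)
      exact ⟨m + n, by omega, Z, hZ, hZX⟩
  have hclosed : ∀ j, IsClosed (⋃₀ survivingTiles f D s j) := fun j =>
    (h.decomposition j).isClosed_sUnion fun _ h => h.1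
  obtain ⟨x, hx⟩ := IsCompact.nonempty_iInter_of_sequence_nonempty_isCompact_isClosed
    (fun j : ℕ => ⋃₀ survivingTiles f D s (j + 1))
    (fun j => h.sUnion_survivingTiles_succ_subset hinv hs (by omega))
    (fun j => by
      obtain ⟨m, hm, Y, hY, -⟩ := key (j + 1)
      obtain ⟨y, hy⟩ := hY.2.1.nonempty
      exact ⟨y, h.sUnion_survivingTiles_subset hinv hs (by omega) hm ⟨Y, hY, hy⟩⟩)
    (hclosed _).isCompact (fun j => hclosed _)
  refine ⟨x, mem_survivingLimit.2 fun n hn => ?_⟩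
  obtain ⟨m, rfl⟩ := Nat.exists_eq_add_of_le' hn
  exact mem_iInter.1 hx m

end IsTower

theorem isClosed_survivingLimit {S : Type*} [TopologicalSpace S] [CompactSpace S] [T2Space S]
    {f : S → S} {D : ℕ → Set (Set S)} (h : IsTower f D) (s : Set S) :
    IsClosed (survivingLimit f D s) :=
  isClosed_iInter fun n => isClosed_iInter fun _ =>
    (h.decomposition n).isClosed_sUnion fun _ h => h.1

/-! ### Comparison with subsystems -/

section Subsystem

variable {S : Type*} {f : S → S} {s : Set S}

theorem mem_iter_res {n : ℕ} {x y : S} :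
    y ∈ iter (PFun.res f s) n x ↔ (∀ i < n, f^[i] x ∈ s) ∧ f^[n] x = y := by
  induction n generalizing x with
  | zero => simp [iter, eq_comm]
  | succ n ih =>
    have hbind : y ∈ iter (PFun.res f s) (n + 1) x ↔
        ∃ z ∈ PFun.res f s x, y ∈ iter (PFun.res f s) n z := Part.mem_bind_iff
    simp only [hbind, PFun.mem_res, ih]
    constructor
    · rintro ⟨z, ⟨hx, rfl⟩, h, rfl⟩
      refine ⟨fun i hi => ?_, rfl⟩
      cases i with
      | zero => exact hx
      | succ i => exact h i (by omega)
    · rintro ⟨h, rfl⟩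
      exact ⟨f x, ⟨h 0 (by omega), rfl⟩, fun i hi => h (i + 1) (by omega), rfl⟩

theorem preimage_iter_res (n : ℕ) :
    (iter (PFun.res f s) n).preimage ((PFun.res f s).image (PFun.res f s).Dom) =
      survivors f s n := by
  have himage : (PFun.res f s).image (PFun.res f s).Dom = f '' s := by
    ext y
    simp only [PFun.mem_image, PFun.mem_dom, PFun.mem_res, mem_image]
    exact ⟨fun ⟨x, _, hx, hy⟩ => ⟨x, hx, hy⟩, fun ⟨x, hx, hy⟩ => ⟨x, ⟨y, hx, hy⟩, hx, hy⟩⟩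
  rw [himage]
  ext x
  simp only [PFun.mem_preimage, mem_iter_res, survivors, mem_ofPred_eq]
  exact ⟨fun ⟨y, hy, h, he⟩ => ⟨h, he ▸ hy⟩, fun ⟨h, hy⟩ => ⟨_, hy, h, rfl⟩⟩

theorem image_iter_res {n : ℕ} {X : Set S} (hX : X ⊆ survivors f s n) :
    (iter (PFun.res f s) n).image X = f^[n] '' X := by
  ext y
  simp only [PFun.mem_image, mem_iter_res, mem_image]
  exact ⟨fun ⟨x, hx, _, he⟩ => ⟨x, hx, he⟩, fun ⟨x, hx, he⟩ => ⟨x, hx, (hX hx).1, he⟩⟩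

theorem subTiles_res [TopologicalSpace S] [OrientedSphere S] (C : Set S) (n : ℕ) :
    subTiles f C (PFun.res f s) n = survivingTiles f (cells f C) s n := by
  ext X
  simp only [subTiles, survivingTiles, tiles, preimage_iter_res, mem_ofPred_eq, and_assoc]

theorem limitSet_res [TopologicalSpace S] [OrientedSphere S] (C : Set S) :
    limitSet f C (PFun.res f s) = survivingLimit f (cells f C) s := by
  simp only [limitSet, survivingLimit, subTiles_res]

theorem mem_colorTiles_res_iff [TopologicalSpace S] [OrientedSphere S] {C : Set S} {n : ℕ}
    {A X : Set S} : X ∈ colorTiles f C (PFun.res f s) n A ↔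
      X ∈ survivingTiles f (cells f C) s n ∧ f^[n] '' X = A := by
  simp only [colorTiles, subTiles_res, mem_ofPred_eq]
  refine and_congr_right fun hX => ?_
  rw [image_iter_res hX.2.2]

end Subsystem

/-- `cells` is empty by default if no cell sequence exists, so a single tile certifies that one
does. -/
theorem isCellSequence_cells {S : Type*} [TopologicalSpace S] [OrientedSphere S] {f : S → S}
    {C : Set S} {n : ℕ} (hne : (tiles f C n).Nonempty) : IsCellSequence f C (cells f C) := by
  have hex : ∃ D, IsCellSequence f C D := by
    by_contra hex
    obtain ⟨X, hX, -⟩ := hne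
    simp [cells, hex] at hX
  have : cells f C = hex.choose := by
    ext n : 1
    simp [cells, hex]
  rw [this]
  exact hex.choose_spec

theorem IsCellSequence.isTower {S : Type*} [TopologicalSpace S] [OrientedSphere S] {f : S → S}
    {C : Set S} {D : ℕ → Set (Set S)} (h : IsCellSequence f C D) (hf : Continuous f) :
    IsTower f D :=
  ⟨hf, h.2.1, h.2.2⟩

/-- The tiles for any curve shrink, if `f` is expanding. -/
theorem IsExpanding.eventually_diam_lt {S : Type*} [τ : TopologicalSpace S] [OrientedSphere S]
    [CompactSpace S] {f : S → S} (hexp : IsExpanding f) (hf : Continuous f)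
    {D : ℕ → Set (Set S)} (hD : IsTower f D) :
    ∃ d : MetricSpace S, d.toPseudoMetricSpace.toUniformSpace.toTopologicalSpace = τ ∧
      ∀ ε > 0, ∀ᶠ n in atTop, ∀ X ∈ D n, Metric.diam X < ε := by
  obtain ⟨C, -, -, 𝒯, rfl, d, rfl, m, hm, hlim⟩ := hexp
  refine ⟨d, rfl, fun ε hε => ?_⟩
  -- The maximal diameter at level 0 is attained, so a 0-tile exists for the curve that witnesses
  -- expansion.
  have hne : (tiles f C 0).Nonempty := image_nonempty.1 ⟨_, (hm 0).1⟩
  refine hD.eventually_diam_lt (locallyPlanar_of_orientedSphere S)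
    ((isCellSequence_cells hne).isTower hf) (fun ε hε => ?_) hε
  filter_upwards [hlim.eventually_lt_const hε] with n hn X hX h2
  exact ((hm n).2 (mem_image_of_mem _ ⟨hX, h2⟩)).trans hn.le

/-- An open set that meets the limit set contains a point of the limit set that is sent to `y` by
`l + n` iterations, if a tile of level `l` leads from the image `A` of a small tile of level `n` to
a 0-tile `B` around `y`. Here `n` and `A` depend on the open set only. -/
theorem exists_hitting_time {S : Type*} [τ : TopologicalSpace S] [OrientedSphere S] [CompactSpace S]
    [T2Space S] {f : S → S} (hexp : IsExpanding f) {D : ℕ → Set (Set S)} (h : IsTower f D)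
    (hinv : MapsTo f (skeleton (D 0)) (skeleton (D 0))) {s : Set S}
    (hs : ∃ 𝔛 ⊆ {X ∈ D 1 | IsCell 2 X}, s = ⋃₀ 𝔛) {U : Set S} (hU : IsOpen U) {x : S}
    (hxU : x ∈ U) (hx : x ∈ survivingLimit f D s) :
    ∃ n, ∃ A ∈ D 0, IsCell 2 A ∧ ∀ y ∈ survivingLimit f D s, ∃ B ∈ D 0, IsCell 2 B ∧
      ∀ l, ∀ T ∈ survivingTiles f D s l, T ⊆ A → f^[l] '' T = B →
        ∃ z ∈ U, z ∈ survivingLimit f D s ∧ f^[l + n] z = y := by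
  obtain ⟨d, rfl, hd⟩ := hexp.eventually_diam_lt h.continuous h
  obtain ⟨ε, hε, hball⟩ := Metric.isOpen_iff.1 hU x hxU
  obtain ⟨n, hn, hn1⟩ := ((hd ε hε).and (eventually_ge_atTop 1)).exists
  obtain ⟨X, hX, hxX⟩ := mem_survivingLimit.1 hx n hn1
  have hXU : X ⊆ U := fun z hz => hball ((Metric.dist_le_diam_of_mem
    ((h.decomposition n).isCompact hX.1).isBounded hz hxX).trans_lt (hn X hX.1))
  refine ⟨n, f^[n] '' X, h.image_mem (by simpa using hX.1),
    (h.isCell_image_iff hX.1 le_rfl).2 hX.2.1, fun y hy => ?_⟩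
  obtain ⟨B, hB, hB2, hyB⟩ := h.exists_zeroTile_frequently hinv hy
  refine ⟨B, hB, hB2, fun l T hT hTA hTB => ?_⟩
  obtain ⟨z, hzX, hz, hzy⟩ := h.exists_mem_survivingLimit_iterate_eq hinv hs
    (locallyPlanar_of_orientedSphere S) hX hT hTA hTB hyB
  exact ⟨z, hXU hzX, hz, hzy⟩

end ThurstonMap

theorem proposition6p8 {S : Type*} [TopologicalSpace S] [ThurstonMap.OrientedSphere S]
    (f : S → S) (hf : ThurstonMap.IsThurstonMap f) (hexp : ThurstonMap.IsExpanding f)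
    (C : Set S) (hC : ThurstonMap.IsJordanCurve C) (hpost : ThurstonMap.post f ⊆ C)
    (hinv : f '' C ⊆ C)
    (F : S →. S) (hF : ThurstonMap.IsSubsystem f C F) :
    -- the restriction of `F` to the tile maximal invariant set is a well-defined continuous
    -- self-map `T`
    ∃ T : ThurstonMap.limitSet f C F → ThurstonMap.limitSet f C F,
      (∀ x : ThurstonMap.limitSet f C F, (T x : S) ∈ F (x : S)) ∧ Continuous T ∧
      (ThurstonMap.IsIrreducible f C F →
        ThurstonMap.TopTransitive T ∧ ThurstonMap.HasDenseForwardOrbit T) ∧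
      (ThurstonMap.IsPrimitive f C F → ThurstonMap.TopMixing T) := by
  open ThurstonMap in
  obtain ⟨𝔛, h𝔛, hne, rfl⟩ := hF
  have hcompact : CompactSpace S := (OrientedSphere.toRiemannSphere (S := S)).symm.compactSpace
  have hT2 : T2Space S := (OrientedSphere.toRiemannSphere (S := S)).symm.t2Space
  have hseq : IsCellSequence f C (cells f C) := isCellSequence_cells (hne.mono h𝔛)
  have hfc : Continuous f := hf.branched.1
  have h : IsTower f (cells f C) := hseq.isTower hfc
  have h0 : cells f C 0 = zeroCells f C := hseq.1
  have hD0 : IsCellDecomposition (zeroCells f C) := h0 ▸ h.decomposition 0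
  have hskel : skeleton (cells f C 0) = C := by rw [h0]; exact skeleton_zeroCells hC hpost hD0
  have hinv' : MapsTo f (skeleton (cells f C 0)) (skeleton (cells f C 0)) := by
    rw [hskel]
    exact mapsTo_iff_image_subset.2 hinv
  have hzero : ∀ A, A ∈ zeroTiles C ↔ A ∈ cells f C 0 ∧ IsCell 2 A := by
    intro A
    rw [h0]
    exact mem_zeroTiles_iff hC hpost hD0
  generalize hsdef : ⋃₀ 𝔛 = s
  have hs : ∃ 𝔛 ⊆ {X ∈ cells f C 1 | IsCell 2 X}, s = ⋃₀ 𝔛 := ⟨𝔛, h𝔛, hsdef.symm⟩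
  have hlim : limitSet f C (PFun.res f s) = survivingLimit f (cells f C) s := limitSet_res C
  rw [hlim]
  set Λ := survivingLimit f (cells f C) s
  have hmaps : MapsTo f Λ Λ := fun x hx => h.apply_mem_survivingLimit hx
  have hiter : ∀ (n : ℕ) (x : Λ), ((hmaps.restrict f Λ Λ)^[n] x : S) = f^[n] x := by
    intro n x
    rw [hmaps.iterate_restrict n]
    rfl
  have hcont : Continuous (hmaps.restrict f Λ Λ) := hfc.restrict hmaps
  have hhit : ∀ U V : Set Λ, IsOpen U → U.Nonempty → V.Nonempty →
      ∃ n, ∃ A ∈ zeroTiles C, ∃ B ∈ zeroTiles C, ∀ l,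
        (∃ X ∈ colorTiles f C (PFun.res f s) l B, X ⊆ A) →
          ((hmaps.restrict f Λ Λ)^[l + n] '' U ∩ V).Nonempty := by
    rintro U V hU ⟨x, hx⟩ ⟨y, hy⟩
    obtain ⟨U, hU', rfl⟩ := isOpen_induced_iff.1 hU
    obtain ⟨n, A, hA, hA2, hn⟩ := exists_hitting_time hexp h hinv' hs hU' hx x.2
    obtain ⟨B, hB, hB2, hl⟩ := hn y y.2
    refine ⟨n, A, (hzero A).2 ⟨hA, hA2⟩, B, (hzero B).2 ⟨hB, hB2⟩, ?_⟩
    rintro l ⟨X, hX, hXA⟩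
    obtain ⟨hX, hXB⟩ := mem_colorTiles_res_iff.1 hX
    obtain ⟨z, hzU, hz, hzy⟩ := hl l X hX hXA hXB
    exact ⟨y, ⟨⟨z, hz⟩, hzU, Subtype.ext ((hiter _ _).trans hzy)⟩, hy⟩
  refine ⟨hmaps.restrict f Λ Λ, fun x => ?_, hcont, fun hirr => ?_, fun hprim => ?_⟩
  · exact (PFun.mem_res _ _ _ _).2 ⟨mem_of_mem_survivingLimit x.2, rfl⟩
  · have htrans : TopTransitive (hmaps.restrict f Λ Λ) := by
      intro U V hU _ hUne hVne
      obtain ⟨n, A, hA, B, hB, hl⟩ := hhit U V hU hUne hVne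
      obtain ⟨l, -, hX⟩ := hirr B hB A hA
      exact ⟨_, hl l hX⟩
    refine ⟨htrans, ?_⟩
    -- Irreducibility with both colors equal to `A` gives a tile inside `A` that an iterate maps
    -- onto `A`.
    have hΛne : Λ.Nonempty := by
      obtain ⟨X, hX⟩ := hne
      have hA : f^[1] '' X ∈ zeroTiles C := (hzero _).2 ⟨h.image_mem (h𝔛 hX).1,
        (h.isCell_image_iff (h𝔛 hX).1 le_rfl).2 (h𝔛 hX).2⟩
      obtain ⟨n, hn, Y, hY, hYA⟩ := hirr _ hA _ hA
      obtain ⟨hY, hYA'⟩ := mem_colorTiles_res_iff.1 hY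
      exact h.survivingLimit_nonempty hinv' hs (locallyPlanar_of_orientedSphere S) hn hY
        (hYA'.symm ▸ hYA)
    have : Nonempty Λ := hΛne.to_subtype
    have : CompactSpace Λ := isCompact_iff_compactSpace.1 (isClosed_survivingLimit h s).isCompact
    have : SecondCountableTopology S := by
      obtain ⟨d, hd, -⟩ := hexp.eventually_diam_lt hfc h
      subst hd
      infer_instance
    exact htrans.hasDenseForwardOrbit hcont
  · intro U V hU _ hUne hVne
    obtain ⟨n, A, hA, B, hB, hl⟩ := hhit U V hU hUne hVne
    obtain ⟨N, -, hN⟩ := hprim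
    -- The small tile in `U` takes `n` steps to grow to a 0-tile; primitivity covers each remaining
    -- time `m - n ≥ N`.
    refine ⟨N + n, fun m hm => ?_⟩
    obtain ⟨l, rfl⟩ := Nat.exists_eq_add_of_le' (show n ≤ m by omega)
    exact hl l (hN B hB A hA l (by omega))
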